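/- Let $(V,g)$ be a smooth pseudo-Riemannian manifold of dimension $N\ge 1$. A codimension-1 foliation $\mathcal F$ of $V$ is understood as a maximal smooth foliated atlas (charts onto convex open subsets of $\mathbb R^{N}$, covering $V$, whose plaques $\{y^{N}=\mathrm{const}\}$ locally agree on overlaps); its leaves are the classes of points that can be joined by finite chains of plaques, and $T_x\mathcal F$ is the tangent space at $x$ of the leaf through $x$. $\mathcal F$ is non-degenerate if the metric induced on each leaf is non-degenerate everywhere, and transversely orientable if some continuous vector field on $V$ is nowhere tangent to the leaves. For a 1-form $\omega$, $\omega^\sharp$ is the vector field with $g(\omega^\sharp,\cdot)=\omega$, and $g^\sharp(\omega,\omega)=g(\omega^\sharp,\omega^\sharp)$. (i) Let $\mathcal F$ be a non-degenerate codimension-1 foliation of $V$. There is exactly one pair $(P,\Pi)$ of smooth fields of endomorphisms of the tangent spaces with $P+\Pi=1$, $P^2=P$, $\Pi^2=\Pi$, $P\Pi=\Pi P=0$, $\Pi_x(T_xV)=T_x\mathcal F$ and $P_x(T_xV)=(T_x\mathcal F)^{\perp}$ for all $x$. Every point of $V$ has an open neighbourhood $U$ and a smooth 1-form $\omega$ on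 $U$ with $\omega\wedge d\omega=0$ and $g^\sharp(\omega,\omega)\neq 0$ on $U$ such that on $U$ $$P=\frac{\omega^\sharp\otimes\omega}{g^\sharp(\omega,\omega)},\qquad \Pi=1-P .\tag{$*$}$$ A single such $\omega$ defined on all of $V$ exists if and only if $\mathcal F$ is transversely orientable. In particular, if there is a smooth function $t:V\to\mathbb R$ without critical points which is constant on each leaf, then $\omega=dt$ satisfies $\omega\wedge d\omega=0$, $g^\sharp(\omega,\omega)\ne0$ and $(*)$ on all of $V$. (ii) Conversely, let $\omega$ be a smooth 1-form on $V$ with $\omega\wedge d\omega=0$ and $g^\sharp(\omega,\omega)\neq 0$ everywhere. Then there is exactly one codimension-1 foliation $\mathcal F$ of $V$ with $T_x\mathcal F=\ker\omega_x$ for all $x$; it is non-degenerate, and the endomorphism fields $P$, $\Pi$ of $(*)$ are its pair of projectors in the sense of (i). -/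

import Mathlib

open scoped Manifold ContDiff Topology
open Bundle Set

noncomputable section

namespace CodimOne

variable {n : ℕ} {V : Type*} [TopologicalSpace V]
  [ChartedSpace (EuclideanSpace ℝ (Fin (n + 1))) V]

/-! ### Tensor fields -/

variable (n V) in
/-- Not necessarily continuous fields of covectors on `V`. -/
abbrev CovectorField : Type _ := ∀ x : V, TangentSpace (𝓡 (n + 1)) x →L[ℝ] ℝ

variable (n V) in
/-- Not necessarily continuous fields of endomorphisms of the tangent spaces, that is, tensor
fields of type `(1, 1)`. -/
abbrev EndoField : Type _ :=
  ∀ x : V, TangentSpace (𝓡 (n + 1)) x →L[ℝ] TangentSpace (𝓡 (n + 1)) x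

section Smooth

variable [IsManifold (𝓡 (n + 1)) ∞ V]

/-- The covector field `θ` is a smooth 1-form on `U`. -/
def SmoothFormOn (θ : CovectorField n V) (U : Set V) : Prop :=
  ContMDiffOn (𝓡 (n + 1)) ((𝓡 (n + 1)).prod 𝓘(ℝ, EuclideanSpace ℝ (Fin (n + 1)) →L[ℝ] ℝ)) ∞
    (fun x : V ↦ TotalSpace.mk' (EuclideanSpace ℝ (Fin (n + 1)) →L[ℝ] ℝ)
      (E := fun x : V ↦ TangentSpace (𝓡 (n + 1)) x →L[ℝ] ℝ) x (θ x)) U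

/-- The endomorphism field `A` is a smooth section of the bundle of `(1, 1)`-tensors. -/
def SmoothEndo (A : EndoField n V) : Prop :=
  ContMDiff (𝓡 (n + 1)) ((𝓡 (n + 1)).prod 𝓘(ℝ, EuclideanSpace ℝ (Fin (n + 1)) →L[ℝ]
      EuclideanSpace ℝ (Fin (n + 1)))) ∞
    (fun x : V ↦ TotalSpace.mk' (EuclideanSpace ℝ (Fin (n + 1)) →L[ℝ]
        EuclideanSpace ℝ (Fin (n + 1)))
      (E := fun x : V ↦ TangentSpace (𝓡 (n + 1)) x →L[ℝ] TangentSpace (𝓡 (n + 1)) x) x (A x))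

variable (n V) in
/-- A smooth pseudo-Riemannian metric: a smooth field of non-degenerate symmetric bilinear forms
on the tangent spaces. -/
structure PseudoRiemannianMetric where
  /-- the bilinear form on each tangent space -/
  form : ∀ x : V, TangentSpace (𝓡 (n + 1)) x →L[ℝ] TangentSpace (𝓡 (n + 1)) x →L[ℝ] ℝ
  symm : ∀ (x : V) (v w : TangentSpace (𝓡 (n + 1)) x), form x v w = form x w v
  nondegenerate : ∀ (x : V) (v : TangentSpace (𝓡 (n + 1)) x), (∀ w, form x v w = 0) → v = 0
  smooth : ContMDiff (𝓡 (n + 1)) ((𝓡 (n + 1)).prod 𝓘(ℝ, EuclideanSpace ℝ (Fin (n + 1)) →L[ℝ]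
      EuclideanSpace ℝ (Fin (n + 1)) →L[ℝ] ℝ)) ∞
    (fun x : V ↦ TotalSpace.mk' (EuclideanSpace ℝ (Fin (n + 1)) →L[ℝ]
        EuclideanSpace ℝ (Fin (n + 1)) →L[ℝ] ℝ)
      (E := fun x : V ↦
        TangentSpace (𝓡 (n + 1)) x →L[ℝ] TangentSpace (𝓡 (n + 1)) x →L[ℝ] ℝ) x (form x))

end Smooth

/-! ### Integrable 1-forms -/

/-- The local representative of the covector field `θ` in the preferred chart at `x`, namely its
pullback under the inverse of the chart, as a 1-form on the model space. -/
def localRep (θ : CovectorField n V) (x : V) (z : EuclideanSpace ℝ (Fin (n + 1))) :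
    EuclideanSpace ℝ (Fin (n + 1)) [⋀^Fin 1]→L[ℝ] ℝ :=
  ContinuousAlternatingMap.ofSubsingleton ℝ (EuclideanSpace ℝ (Fin (n + 1))) ℝ 0
    ((θ ((extChartAt (𝓡 (n + 1)) x).symm z)).comp
      (mfderiv 𝓘(ℝ, EuclideanSpace ℝ (Fin (n + 1))) (𝓡 (n + 1))
        (extChartAt (𝓡 (n + 1)) x).symm z))

/-- The exterior derivative `dθ` at `x`, computed in the preferred chart at `x`. -/
def extDerivative (θ : CovectorField n V) (x : V) (u v : TangentSpace (𝓡 (n + 1)) x) : ℝ :=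
  extDeriv (localRep θ x) (extChartAt (𝓡 (n + 1)) x x)
    ![mfderiv (𝓡 (n + 1)) 𝓘(ℝ, EuclideanSpace ℝ (Fin (n + 1))) (extChartAt (𝓡 (n + 1)) x) x u,
      mfderiv (𝓡 (n + 1)) 𝓘(ℝ, EuclideanSpace ℝ (Fin (n + 1))) (extChartAt (𝓡 (n + 1)) x) x v]

/-- The value of `θ ∧ dθ` at `x` on three tangent vectors. -/
def wedgeExtDerivative (θ : CovectorField n V) (x : V)
    (u v w : TangentSpace (𝓡 (n + 1)) x) : ℝ :=
  θ x u * extDerivative θ x v w + θ x v * extDerivative θ x w u + θ x w * extDerivative θ x u v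

/-! ### Raising indices -/

section Metric

variable [IsManifold (𝓡 (n + 1)) ∞ V]

namespace PseudoRiemannianMetric

theorem exists_sharp (g : PseudoRiemannianMetric n V) (x : V)
    (α : TangentSpace (𝓡 (n + 1)) x →L[ℝ] ℝ) :
    ∃ v : TangentSpace (𝓡 (n + 1)) x, ∀ w, g.form x v w = α w := by
  have fd : FiniteDimensional ℝ (TangentSpace (𝓡 (n + 1)) x) :=
    inferInstanceAs (FiniteDimensional ℝ (EuclideanSpace ℝ (Fin (n + 1))))
  let f : TangentSpace (𝓡 (n + 1)) x →ₗ[ℝ] Module.Dual ℝ (TangentSpace (𝓡 (n + 1)) x) :=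
    { toFun := fun v ↦ (g.form x v).toLinearMap
      map_add' := fun v w ↦ by ext; simp
      map_smul' := fun c v ↦ by ext; simp }
  have hinj : Function.Injective f := by
    rw [injective_iff_map_eq_zero]
    intro v hv
    exact g.nondegenerate x v fun w ↦ LinearMap.congr_fun hv w
  have hsurj : Function.Surjective f :=
    (LinearMap.injective_iff_surjective_of_finrank_eq_finrank
      (Subspace.dual_finrank_eq).symm).1 hinj
  obtain ⟨v, hv⟩ := hsurj α.toLinearMap
  exact ⟨v, fun w ↦ LinearMap.congr_fun hv w⟩

/-- The vector `α^♯` with `g(α^♯, w) = α(w)` for all `w`. -/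
def sharp (g : PseudoRiemannianMetric n V) (x : V)
    (α : TangentSpace (𝓡 (n + 1)) x →L[ℝ] ℝ) : TangentSpace (𝓡 (n + 1)) x :=
  (g.exists_sharp x α).choose

theorem form_sharp (g : PseudoRiemannianMetric n V) (x : V)
    (α : TangentSpace (𝓡 (n + 1)) x →L[ℝ] ℝ) (w : TangentSpace (𝓡 (n + 1)) x) :
    g.form x (g.sharp x α) w = α w :=
  (g.exists_sharp x α).choose_spec w

/-- The inverse metric `g^♯(α, β)` on covectors. -/
def inverse (g : PseudoRiemannianMetric n V) (x : V)
    (α β : TangentSpace (𝓡 (n + 1)) x →L[ℝ] ℝ) : ℝ :=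
  g.form x (g.sharp x α) (g.sharp x β)

/-- The endomorphism `θ^♯ ⊗ θ / g^♯(θ, θ)`, that is, `v ↦ (θ(v) / g^♯(θ, θ)) θ^♯`. -/
def formProjector (g : PseudoRiemannianMetric n V) (θ : CovectorField n V) : EndoField n V :=
  fun x ↦ (g.inverse x (θ x) (θ x))⁻¹ • (θ x).smulRight (g.sharp x (θ x))

end PseudoRiemannianMetric

/-- `θ` is a smooth 1-form on `U` with `θ ∧ dθ = 0` and `g^♯(θ, θ) ≠ 0` at every point of `U`. -/
structure IsIntegrableNonNullOn (g : PseudoRiemannianMetric n V) (θ : CovectorField n V)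
    (U : Set V) : Prop where
  smooth : SmoothFormOn θ U
  integrable : ∀ x ∈ U, ∀ u v w : TangentSpace (𝓡 (n + 1)) x, wedgeExtDerivative θ x u v w = 0
  nonNull : ∀ x ∈ U, g.inverse x (θ x) (θ x) ≠ 0

/-- `P` and `Q` are the smooth pair of complementary projectors with `D(Q) = D` and `D(P) = D^⊥`,
where `D` is a field of subspaces of the tangent spaces. -/
structure IsProjectorPair (g : PseudoRiemannianMetric n V)
    (D : ∀ x : V, Submodule ℝ (TangentSpace (𝓡 (n + 1)) x)) (P Q : EndoField n V) : Prop where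
  smooth_left : SmoothEndo P
  smooth_right : SmoothEndo Q
  add_eq_id : ∀ x, P x + Q x = ContinuousLinearMap.id ℝ (TangentSpace (𝓡 (n + 1)) x)
  left_idem : ∀ x, (P x).comp (P x) = P x
  right_idem : ∀ x, (Q x).comp (Q x) = Q x
  left_right : ∀ x, (P x).comp (Q x) = 0
  right_left : ∀ x, (Q x).comp (P x) = 0
  range_right : ∀ (x : V) (v : TangentSpace (𝓡 (n + 1)) x), v ∈ range (Q x) ↔ v ∈ D x
  range_left : ∀ (x : V) (v : TangentSpace (𝓡 (n + 1)) x),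
    v ∈ range (P x) ↔ ∀ w ∈ D x, g.form x v w = 0

end Metric

/-! ### Foliations of codimension one -/

/-- The transverse coordinate of a chart: its last coordinate. The plaques of a chart with convex
target are the level sets of this function on the source of the chart. -/
def height (φ : OpenPartialHomeomorph V (EuclideanSpace ℝ (Fin (n + 1)))) (x : V) : ℝ :=
  φ x (Fin.last n)

/-- Near each common point of their domains, the two charts have the same plaques. -/
def PlaqueCompatible (φ ψ : OpenPartialHomeomorph V (EuclideanSpace ℝ (Fin (n + 1)))) : Prop :=
  ∀ x ∈ φ.source ∩ ψ.source, ∃ W ∈ 𝓝 x, ∀ y ∈ W, ∀ z ∈ W,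
    (height φ y = height φ z ↔ height ψ y = height ψ z)

variable (n V) in
/-- A smooth foliation of codimension one of `V`, as a maximal foliated atlas: smooth charts onto
convex open sets, covering `V`, such that any two of them have locally the same plaques. -/
structure Foliation where
  /-- the foliated charts -/
  charts : Set (OpenPartialHomeomorph V (EuclideanSpace ℝ (Fin (n + 1))))
  smooth : ∀ φ ∈ charts, φ ∈ IsManifold.maximalAtlas (𝓡 (n + 1)) ∞ V
  convex : ∀ φ ∈ charts, Convex ℝ φ.target
  cover : ∀ x : V, ∃ φ ∈ charts, x ∈ φ.source
  compatible : ∀ φ ∈ charts, ∀ ψ ∈ charts, PlaqueCompatible φ ψ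
  maximal : ∀ φ ∈ IsManifold.maximalAtlas (𝓡 (n + 1)) ∞ V, Convex ℝ φ.target →
    (∀ ψ ∈ charts, PlaqueCompatible φ ψ) → φ ∈ charts

namespace Foliation

/-- `x` and `y` lie on a common plaque of a foliated chart. -/
def SamePlaque (F : Foliation n V) (x y : V) : Prop :=
  ∃ φ ∈ F.charts, x ∈ φ.source ∧ y ∈ φ.source ∧ height φ x = height φ y

/-- The leaf through `x`: all points that can be joined to `x` by a finite chain of plaques. -/
def leaf (F : Foliation n V) (x : V) : Set V :=
  {y | Relation.EqvGen F.SamePlaque x y}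

/-- The tangent space at `x` of the leaf through `x`: the vectors tangent at `x` to the plaques
through `x`. -/
def tangent (F : Foliation n V) (x : V) : Submodule ℝ (TangentSpace (𝓡 (n + 1)) x) :=
  ⨅ φ ∈ F.charts, ⨅ _ : x ∈ φ.source,
    LinearMap.ker (mfderiv (𝓡 (n + 1)) 𝓘(ℝ, ℝ) (height φ) x).toLinearMap

/-- The metric induced on each leaf is non-degenerate at each of its points. -/
def IsNondegenerate [IsManifold (𝓡 (n + 1)) ∞ V] (F : Foliation n V)
    (g : PseudoRiemannianMetric n V) : Prop :=
  ∀ x : V, ∀ v ∈ F.tangent x, (∀ w ∈ F.tangent x, g.form x v w = 0) → v = 0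

/-- The foliation is transversely orientable: some continuous vector field is nowhere tangent to
the leaves. -/
def IsTransverselyOrientable [IsManifold (𝓡 (n + 1)) ∞ V] (F : Foliation n V) : Prop :=
  ∃ X : ∀ x : V, TangentSpace (𝓡 (n + 1)) x,
    Continuous (fun x : V ↦ (⟨x, X x⟩ : TangentBundle (𝓡 (n + 1)) V)) ∧ ∀ x, X x ∉ F.tangent x

end Foliation

end CodimOne

end

/-!
A codimension-one foliation is locally the family of level sets of the transverse coordinate
`height φ` of a foliated chart, and its tangent spaces are the kernels of `d(height φ)`
(`Foliation.tangent_eq_ker`).  Conversely, charts whose plaques have the same tangent spaces have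
locally the same plaques, since a function whose differential vanishes along the plaques of a chart
is constant along segments of these plaques (`plaqueCompatible_of_ker_mfderiv_eq`).  Hence a
foliation is determined by its tangent spaces, by maximality of the atlas
(`Foliation.eq_of_tangent_eq`).

**The projectors.** At a point, the hyperplane `ker α` is non-degenerate exactly when
`g^♯(α, α) ≠ 0` (`PseudoRiemannianMetric.inverse_ne_zero_iff`), and then `α^♯ ⊗ α / g^♯(α, α)` is
the projector onto `(ker α)^⊥` along `ker α`.  It does not change when `α` is multiplied by a
non-zero number, so it depends only on `ker α`
(`PseudoRiemannianMetric.formProjector_eq_of_ker_eq`).  The projector of a foliation can therefore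
be defined by choosing a foliated chart at each point independently, and be computed, near any
point, by the smooth form `d(height φ)` of a single foliated chart `φ`; smoothness comes from the
smoothness of matrix inversion (`contMDiffAt_formProjector`).

**Transverse orientations.** If `X` is continuous and nowhere tangent to the leaves, then the
multiple `θ` of `d(height φ)` with `g^♯(θ, θ) = ±1` and `θ(X) > 0` does not depend on the chart
`φ`, so it is a global form.  It is smooth because the sign of `d(height φ)(X)` is locally constant,
and integrable because it is locally of the form `f dt`
(`Foliation.IsNondegenerate.exists_form_of_transverse`).  Conversely, `θ^♯` is transverse when
`g^♯(θ, θ) ≠ 0`.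

**The Frobenius theorem.** What remains is that the kernels of a form `η` with `η ∧ dη = 0` are
locally those of an exact form.  On a vector space, write them as the graphs
`{v + a(z)(v) e | ℓ v = 0}` of linear maps `a(z)` on a fixed hyperplane `ker ℓ`.  From a point
`z = z₀ + h + y e` with `h ∈ ker ℓ`, follow the curve tangent to the distribution over the segment
from `h` to `0`; it reaches the axis `z₀ + ℝ e` at a point `z₀ + t(z) e`, which defines a first
integral `t`.  Smooth dependence on `z` follows from the inverse function theorem applied to the
integral equation on `C([0, 1], ℝ)` (`exists_radialSolution`), because superposition operators of
smooth maps are smooth (`contDiff_superposition`).  The derivative of `t` along the distribution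
solves a homogeneous linear equation with zero initial value, by integrability
(`radial_variation_eq_zero`), so `dt` vanishes on `ker η`.  Since both `θ ∧ dθ` and the kernels are
natural under changes of charts (`wedgeDeriv_localForm`), this gives foliated charts on the manifold
(`exists_chart_ker_eq`).
-/

noncomputable section

namespace CodimOne

/-! ### Superposition operators, inverse functions and cut-offs -/

section Superposition

universe u
variable {K : Type*} [TopologicalSpace K] [CompactSpace K]
  {E F : Type u} [NormedAddCommGroup E] [NormedSpace ℝ E] [NormedAddCommGroup F] [NormedSpace ℝ F]

/-- A shortcut instance: unification with function spaces of operators is otherwise slow. -/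
instance normedAddCommGroupContinuousMapOperator : NormedAddCommGroup C(K, E →L[ℝ] F) :=
  ContinuousMap.instNormedAddCommGroup

/-- A shortcut instance, see `normedAddCommGroupContinuousMapOperator`. -/
instance normedSpaceContinuousMapOperator : NormedSpace ℝ C(K, E →L[ℝ] F) :=
  ContinuousMap.normedSpace

/-- Pointwise application of a bilinear map to continuous families of vectors, as a continuous
bilinear map. -/
def pointwiseBilinear (K : Type*) [TopologicalSpace K] [CompactSpace K] {G E F : Type*}
    [NormedAddCommGroup G] [NormedSpace ℝ G]
    [NormedAddCommGroup E] [NormedSpace ℝ E] [NormedAddCommGroup F] [NormedSpace ℝ F]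
    (B : G →L[ℝ] E →L[ℝ] F) : C(K, G) →L[ℝ] C(K, E) →L[ℝ] C(K, F) :=
  LinearMap.mkContinuous₂
    (LinearMap.mk₂ ℝ
      (fun (A : C(K, G)) (v : C(K, E)) ↦ (⟨fun k ↦ B (A k) (v k), by fun_prop⟩ : C(K, F)))
      (fun A B v ↦ by ext; simp) (fun c A v ↦ by ext; simp)
      (fun A v w ↦ by ext; simp) (fun c A v ↦ by ext; simp)) ‖B‖
    (fun A v ↦ by
      rw [ContinuousMap.norm_le _ (by positivity)]
      intro k
      refine (B.le_opNorm₂ (A k) (v k)).trans ?_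
      gcongr
      · exact A.norm_coe_le_norm k
      · exact v.norm_coe_le_norm k)

variable (K E F) in
/-- Pointwise application of a continuous family of operators to a continuous family of vectors,
as a continuous bilinear map. -/
def pointwiseApply : C(K, E →L[ℝ] F) →L[ℝ] C(K, E) →L[ℝ] C(K, F) :=
  pointwiseBilinear K (ContinuousLinearMap.id ℝ (E →L[ℝ] F))

/-- The superposition operator `γ ↦ f ∘ γ` of a continuous map `f` with continuous derivative `f'`
is differentiable for the sup norm, with derivative `v ↦ f'(γ) v`. -/
theorem hasFDerivAt_superposition (f : C(E, F)) (f' : C(E, E →L[ℝ] F))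
    (hf : ∀ x, HasFDerivAt f (f' x) x) (γ : C(K, E)) :
    HasFDerivAt (fun γ : C(K, E) ↦ f.comp γ) (pointwiseApply K E F (f'.comp γ)) γ := by
  rw [hasFDerivAt_iff_isLittleO_nhds_zero, Asymptotics.isLittleO_iff]
  intro ε hε
  have hcont : ContinuousAt (fun γ : C(K, E) ↦ f'.comp γ) γ :=
    (ContinuousMap.continuous_postcomp f').continuousAt
  obtain ⟨δ, hδ, hball⟩ := Metric.continuousAt_iff.1 hcont ε hε
  filter_upwards [Metric.ball_mem_nhds (0 : C(K, E)) hδ] with v hv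
  rw [ContinuousMap.norm_le _ (by positivity)]
  intro k
  have hseg : ∀ y ∈ segment ℝ (γ k) (γ k + v k), ‖f' y - f' (γ k)‖ ≤ ε := by
    intro y hy
    rw [segment_eq_image'] at hy
    obtain ⟨τ, hτ, rfl⟩ := hy
    have h1 : dist (γ + τ • v) γ < δ := by
      rw [dist_eq_norm, add_sub_cancel_left, norm_smul, Real.norm_of_nonneg hτ.1]
      have : ‖v‖ < δ := by simpa using hv
      nlinarith [norm_nonneg v, hτ.2]
    have h2 := (ContinuousMap.dist_apply_le_dist k).trans (hball h1).le
    rw [dist_eq_norm] at h2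
    simpa using h2
  have := (convex_segment (γ k) (γ k + v k)).norm_image_sub_le_of_norm_hasFDerivWithin_le'
    (fun y _ ↦ (hf y).hasFDerivWithinAt) hseg (left_mem_segment _ _ _) (right_mem_segment _ _ _)
  simp only [add_sub_cancel_left] at this
  refine this.trans ?_
  gcongr
  exact v.norm_coe_le_norm k

/-- The superposition operator of a `C^m` map is `C^m` for the sup norm. -/
theorem contDiff_superposition_nat (m : ℕ) : ∀ {F : Type u} [NormedAddCommGroup F]
    [NormedSpace ℝ F] (f : C(E, F)), ContDiff ℝ m f →
    ContDiff ℝ m (fun γ : C(K, E) ↦ f.comp γ) := by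
  induction m with
  | zero =>
    intro F _ _ f _
    exact contDiff_zero.2 (ContinuousMap.continuous_postcomp f)
  | succ m ih =>
    intro F _ _ f hf
    let f' : C(E, E →L[ℝ] F) := ⟨fderiv ℝ f, hf.continuous_fderiv (by simp)⟩
    have hd : ∀ x, HasFDerivAt f (f' x) x := fun x ↦
      (hf.differentiable (by simp) x).hasFDerivAt
    have hf' : ContDiff ℝ m f' := hf.fderiv_right (by norm_cast)
    rw [show ((m + 1 : ℕ) : WithTop ℕ∞) = (m : WithTop ℕ∞) + 1 by norm_cast,
      contDiff_succ_iff_hasFDerivAt]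
    · exact ⟨_, (pointwiseApply K E F).contDiff.comp (ih f' hf'),
        fun γ ↦ hasFDerivAt_superposition f f' hd γ⟩

theorem contDiff_superposition (f : C(E, F)) (hf : ContDiff ℝ ∞ f) :
    ContDiff ℝ ∞ (fun γ : C(K, E) ↦ f.comp γ) :=
  contDiff_infty.2 fun m ↦ contDiff_superposition_nat m f (contDiff_infty.1 hf m)

end Superposition

section Primitive

/-- The primitive vanishing at `0`, as a continuous operator on `C([0, 1], ℝ)`. -/
def primitive : C(unitInterval, ℝ) →L[ℝ] C(unitInterval, ℝ) :=
  LinearMap.mkContinuous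
    { toFun := fun γ ↦ ⟨fun s ↦ ∫ σ in (0 : ℝ)..s, γ (projIcc 0 1 zero_le_one σ), by
        have : Continuous fun s : ℝ ↦ ∫ σ in (0 : ℝ)..s, γ (projIcc 0 1 zero_le_one σ) :=
          intervalIntegral.continuous_primitive
            (fun a b ↦ (by fun_prop : Continuous fun σ : ℝ ↦
              γ (projIcc 0 1 zero_le_one σ)).intervalIntegrable a b) 0
        fun_prop⟩
      map_add' := fun γ δ ↦ by
        ext s
        exact intervalIntegral.integral_add
          ((by fun_prop : Continuous fun σ : ℝ ↦
              γ (projIcc 0 1 zero_le_one σ)).intervalIntegrable _ _)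
          ((by fun_prop : Continuous fun σ : ℝ ↦
              δ (projIcc 0 1 zero_le_one σ)).intervalIntegrable _ _)
      map_smul' := fun c γ ↦ by
        ext s
        exact intervalIntegral.integral_smul c _ } 1
    (fun γ ↦ by
      rw [ContinuousMap.norm_le _ (by positivity)]
      intro s
      have := intervalIntegral.norm_integral_le_of_norm_le_const (a := (0 : ℝ)) (b := s)
        (f := fun σ ↦ γ (projIcc 0 1 zero_le_one σ)) (C := ‖γ‖) (fun σ _ ↦ γ.norm_coe_le_norm _)
      refine this.trans ?_
      rw [sub_zero, abs_of_nonneg s.2.1, one_mul]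
      exact mul_le_of_le_one_right (norm_nonneg _) s.2.2)

theorem primitive_apply (γ : C(unitInterval, ℝ)) (s : unitInterval) :
    primitive γ s = ∫ σ in (0 : ℝ)..s, γ (projIcc 0 1 zero_le_one σ) := rfl

end Primitive

section Inverse

variable {E F : Type*} [NormedAddCommGroup E] [NormedSpace ℝ E] [CompleteSpace E]
  [NormedAddCommGroup F] [NormedSpace ℝ F]

/-- The inverse function theorem with an inverse which is smooth on a whole neighbourhood. -/
theorem exists_openPartialHomeomorph_contDiffOn {f : E → F} {U : Set E} (hU : IsOpen U)
    (hf : ContDiffOn ℝ ∞ f U) {a : E} (ha : a ∈ U) (f' : E ≃L[ℝ] F)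
    (hf' : HasFDerivAt f (f' : E →L[ℝ] F) a) :
    ∃ φ : OpenPartialHomeomorph E F, a ∈ φ.source ∧ φ.source ⊆ U ∧ ⇑φ = f ∧
      ContDiffOn ℝ ∞ φ.symm φ.target := by
  have hfa : ContDiffAt ℝ ∞ f a := hf.contDiffAt (hU.mem_nhds ha)
  have hcont : ContinuousOn (fderiv ℝ f) U := hf.continuousOn_fderiv_of_isOpen hU (by simp)
  let G : Set E := U ∩ fderiv ℝ f ⁻¹' range ((↑) : (E ≃L[ℝ] F) → E →L[ℝ] F)
  have hG : IsOpen G := hcont.isOpen_inter_preimage hU ContinuousLinearEquiv.isOpen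
  have haG : a ∈ G := ⟨ha, f', hf'.fderiv.symm⟩
  let φ := (hfa.toOpenPartialHomeomorph f hf' (by simp)).restrOpen G hG
  have hsub : φ.source ⊆ G := fun x hx ↦ hx.2
  refine ⟨φ, ⟨hfa.mem_toOpenPartialHomeomorph_source hf' (by simp), haG⟩,
    fun x hx ↦ (hsub hx).1, rfl, fun y hy ↦ ?_⟩
  obtain ⟨hyU, e, he⟩ := hsub (φ.map_target hy)
  have hfy : ContDiffAt ℝ ∞ f (φ.symm y) := hf.contDiffAt (hU.mem_nhds hyU)
  refine (φ.contDiffAt_symm (f₀' := e) hy ?_ hfy).contDiffWithinAt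
  rw [he]
  exact (hfy.differentiableAt (by simp)).hasFDerivAt

end Inverse

section Cutoff

variable {E F : Type*} [NormedAddCommGroup E] [NormedSpace ℝ E] [HasContDiffBump E]
  [NormedAddCommGroup F] [NormedSpace ℝ F]

/-- A function which is smooth on a neighbourhood of a point agrees near it with a globally smooth
one. -/
theorem exists_contDiff_eventuallyEq {f : E → F} {U : Set E} (hU : IsOpen U)
    (hf : ContDiffOn ℝ ∞ f U) {a : E} (ha : a ∈ U) :
    ∃ g : E → F, ContDiff ℝ ∞ g ∧ g =ᶠ[𝓝 a] f := by
  obtain ⟨r, hr, hrU⟩ := Metric.nhds_basis_closedBall.mem_iff.1 (hU.mem_nhds ha)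
  let χ : ContDiffBump a := ⟨r / 2, r, by positivity, by linarith⟩
  refine ⟨fun x ↦ χ x • f x, ?_, ?_⟩
  · rw [contDiff_iff_contDiffAt]
    intro x
    by_cases hx : x ∈ U
    · exact χ.contDiffAt.smul (hf.contDiffAt (hU.mem_nhds hx))
    · have hx' : x ∉ tsupport χ := fun h ↦ hx (hrU (by rwa [χ.tsupport_eq] at h))
      have : (fun x ↦ χ x • f x) =ᶠ[𝓝 x] fun _ ↦ 0 := by
        filter_upwards [notMem_tsupport_iff_eventuallyEq.1 hx'] with y hy
        simp [hy]
      exact contDiffAt_const.congr_of_eventuallyEq this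
  · filter_upwards [χ.eventuallyEq_one] with y hy
    simp [hy]

end Cutoff

/-! ### The radial equation -/

section RadialEquation

variable {E : Type} [NormedAddCommGroup E] [NormedSpace ℝ E]

/-- The affine embedding of parameters and unknowns of the radial equation into the space of
curves `s ↦ (s, h, γ s)`: its linear part. -/
def curveLinear : E × C(unitInterval, ℝ) →L[ℝ] C(unitInterval, ℝ × E × ℝ) :=
  LinearMap.mkContinuous
    { toFun := fun p ↦ ⟨fun s ↦ (0, p.1, p.2 s), by fun_prop⟩
      map_add' := fun p q ↦ by ext s <;> simp
      map_smul' := fun c p ↦ by ext s <;> simp } 1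
    (fun p ↦ by
      rw [ContinuousMap.norm_le _ (by positivity), one_mul]
      intro s
      simp only [LinearMap.coe_mk, AddHom.coe_mk, ContinuousMap.coe_mk, Prod.norm_def, norm_zero]
      refine max_le ((norm_nonneg _).trans (le_max_left _ _)) (max_le_max le_rfl ?_)
      exact p.2.norm_coe_le_norm s)

@[simp]
theorem curveLinear_apply (p : E × C(unitInterval, ℝ)) (s : unitInterval) :
    curveLinear p s = (0, p.1, p.2 s) := rfl

/-- The linear projection onto the kernel of `ℓ` along `e`, when `ℓ e = 1`. -/
def projAlong (ℓ : E →L[ℝ] ℝ) (e : E) : E →L[ℝ] E :=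
  ContinuousLinearMap.id ℝ E - ℓ.smulRight e

@[simp]
theorem projAlong_apply (ℓ : E →L[ℝ] ℝ) (e v : E) : projAlong ℓ e v = v - ℓ v • e := rfl

/-- The curve `s ↦ (s, h, γ s)`, where `h` is the component of `z - z₀` in the kernel of `ℓ`. -/
def curveOf (z₀ : E) (ℓ : E →L[ℝ] ℝ) (e : E) (p : E × C(unitInterval, ℝ)) :
    C(unitInterval, ℝ × E × ℝ) :=
  curveLinear (projAlong ℓ e (p.1 - z₀), p.2) + ⟨fun s ↦ ((s : ℝ), 0, 0), by fun_prop⟩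

theorem curveOf_apply (z₀ : E) (ℓ : E →L[ℝ] ℝ) (e : E) (p : E × C(unitInterval, ℝ))
    (s : unitInterval) :
    curveOf z₀ ℓ e p s = ((s : ℝ), projAlong ℓ e (p.1 - z₀), p.2 s) := by
  ext <;> simp [curveOf]

theorem hasFDerivAt_curveOf (z₀ : E) (ℓ : E →L[ℝ] ℝ) (e : E) (p : E × C(unitInterval, ℝ)) :
    HasFDerivAt (curveOf z₀ ℓ e)
      (curveLinear.comp ((projAlong ℓ e).prodMap (ContinuousLinearMap.id ℝ _))) p := by
  have h1 : HasFDerivAt (fun p : E × C(unitInterval, ℝ) ↦ (projAlong ℓ e (p.1 - z₀), p.2))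
      ((projAlong ℓ e).prodMap (ContinuousLinearMap.id ℝ _)) p := by
    refine HasFDerivAt.prodMk ?_ hasFDerivAt_snd
    exact (projAlong ℓ e).hasFDerivAt.comp p (hasFDerivAt_fst.sub_const z₀)
  exact (curveLinear.hasFDerivAt.comp p h1).add_const _

theorem contDiff_curveOf (z₀ : E) (ℓ : E →L[ℝ] ℝ) (e : E) :
    ContDiff ℝ ∞ (curveOf z₀ ℓ e) := by
  unfold curveOf
  exact (curveLinear.contDiff.comp
    (((projAlong ℓ e).contDiff.comp (contDiff_fst.sub contDiff_const)).prodMk contDiff_snd)).add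
    contDiff_const

/-- The point `z₀ + (1 - s) h + y e`. -/
def radialPoint (z₀ e : E) (q : ℝ × E × ℝ) : E := z₀ + (1 - q.1) • q.2.1 + q.2.2 • e

/-- The slope `a(z₀ + (1 - s) h + y e) h` of the radial equation. -/
def radialSlope (a : E → E →L[ℝ] ℝ) (z₀ e : E) (q : ℝ × E × ℝ) : ℝ :=
  a (radialPoint z₀ e q) q.2.1

theorem contDiff_radialPoint (z₀ e : E) : ContDiff ℝ ∞ (radialPoint z₀ e) := by
  unfold radialPoint
  fun_prop

theorem contDiff_radialSlope {a : E → E →L[ℝ] ℝ} (ha : ContDiff ℝ ∞ a) (z₀ e : E) :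
    ContDiff ℝ ∞ (radialSlope a z₀ e) :=
  (ha.comp (contDiff_radialPoint z₀ e)).clm_apply (by fun_prop)

theorem radialSlope_add_smul (a : E → E →L[ℝ] ℝ) (z₀ e : E) (q : ℝ × E × ℝ) (k : E) (δ τ : ℝ) :
    radialSlope a z₀ e (q + τ • (0, k, δ)) =
      a (radialPoint z₀ e q + τ • ((1 - q.1) • k + δ • e)) (q.2.1 + τ • k) := by
  obtain ⟨s, h, y⟩ := q
  have : radialPoint z₀ e ((s, h, y) + τ • (0, k, δ)) =
      radialPoint z₀ e (s, h, y) + τ • ((1 - s) • k + δ • e) := by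
    simp only [radialPoint, Prod.smul_mk, Prod.mk_add_mk, smul_eq_mul]
    module
  rw [radialSlope, this]
  rfl

theorem fderiv_radialSlope_apply {a : E → E →L[ℝ] ℝ} (ha : ContDiff ℝ ∞ a) (z₀ e : E)
    (q : ℝ × E × ℝ) (k : E) (δ : ℝ) :
    fderiv ℝ (radialSlope a z₀ e) q (0, k, δ) =
      fderiv ℝ a (radialPoint z₀ e q) ((1 - q.1) • k + δ • e) q.2.1 +
        a (radialPoint z₀ e q) k := by
  have h1 := ((contDiff_radialSlope ha z₀ e).differentiable (by simp) q).hasFDerivAt.hasLineDerivAt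
    (0, k, δ)
  rw [HasLineDerivAt] at h1
  simp only [radialSlope_add_smul] at h1
  have h2 := ((ha.differentiable (by simp) (radialPoint z₀ e q)).hasFDerivAt.hasLineDerivAt
    ((1 - q.1) • k + δ • e)).clm_apply
    ((((hasDerivAt_id (0 : ℝ)).smul_const k).const_add q.2.1))
  simpa using h1.unique h2

/-- The radial equation as a map between Banach spaces: its zeros `(z, γ)` are the curves with
`γ s = ℓ (z - z₀) - ∫₀ˢ a(z₀ + (1 - σ) h + γ(σ) e) h dσ`. -/
def radialMap (f : C(ℝ × E × ℝ, ℝ)) (z₀ : E) (ℓ : E →L[ℝ] ℝ) (e : E)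
    (p : E × C(unitInterval, ℝ)) : C(unitInterval, ℝ) :=
  p.2 - ℓ (p.1 - z₀) • (1 : C(unitInterval, ℝ)) + primitive (f.comp (curveOf z₀ ℓ e p))

theorem contDiff_radialMap {f : C(ℝ × E × ℝ, ℝ)} (hf : ContDiff ℝ ∞ f) (z₀ : E)
    (ℓ : E →L[ℝ] ℝ) (e : E) : ContDiff ℝ ∞ (radialMap f z₀ ℓ e) := by
  unfold radialMap
  refine (contDiff_snd.sub ?_).add (primitive.contDiff.comp
    ((contDiff_superposition f hf).comp (contDiff_curveOf z₀ ℓ e)))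
  exact (ℓ.contDiff.comp (contDiff_fst.sub contDiff_const)).smul contDiff_const

/-- The left hand side of the linearised radial equation. -/
theorem fderiv_radialMap_apply {f : C(ℝ × E × ℝ, ℝ)} (hf : ContDiff ℝ ∞ f) (z₀ : E)
    (ℓ : E →L[ℝ] ℝ) (e : E) (p : E × C(unitInterval, ℝ)) (u : E) (Z : C(unitInterval, ℝ)) :
    fderiv ℝ (radialMap f z₀ ℓ e) p (u, Z) = Z - ℓ u • (1 : C(unitInterval, ℝ)) +
      primitive ⟨fun s ↦ fderiv ℝ f (curveOf z₀ ℓ e p s) (0, projAlong ℓ e u, Z s), by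
        have := hf.continuous_fderiv (by simp); fun_prop⟩ := by
  let f' : C(ℝ × E × ℝ, ℝ × E × ℝ →L[ℝ] ℝ) := ⟨fderiv ℝ f, hf.continuous_fderiv (by simp)⟩
  have h1 := (hasFDerivAt_superposition (K := unitInterval) f f'
    (fun x ↦ (hf.differentiable (by simp) x).hasFDerivAt) (curveOf z₀ ℓ e p)).comp p
      (hasFDerivAt_curveOf z₀ ℓ e p)
  have h2 := primitive.hasFDerivAt.comp p h1
  have h3 : HasFDerivAt (fun p : E × C(unitInterval, ℝ) ↦
      ℓ (p.1 - z₀) • (1 : C(unitInterval, ℝ))) _ p :=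
    (ℓ.hasFDerivAt.comp p (hasFDerivAt_fst.sub_const z₀)).smul_const 1
  have h4 := (hasFDerivAt_snd.sub h3).add h2
  have h5 : fderiv ℝ (radialMap f z₀ ℓ e) p = _ := h4.fderiv
  rw [h5]
  rfl

/-- Smooth dependence of the solution of the radial equation on the end point `z`. The equation
is trivial at `z = z₀`, so the derivative in the unknown curve is the identity there and the
inverse function theorem applies. -/
theorem exists_radialSolution [CompleteSpace E] {a : E → E →L[ℝ] ℝ} (ha : ContDiff ℝ ∞ a) (z₀ : E)
    (ℓ : E →L[ℝ] ℝ) (e : E) (f : C(ℝ × E × ℝ, ℝ)) (hfa : ⇑f = radialSlope a z₀ e) :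
    ∃ U : Set E, IsOpen U ∧ z₀ ∈ U ∧ ∃ γ : E → C(unitInterval, ℝ), ContDiffOn ℝ ∞ γ U ∧
      γ z₀ = 0 ∧ ∀ z ∈ U, radialMap f z₀ ℓ e (z, γ z) = 0 := by
  have hf : ContDiff ℝ ∞ f := hfa ▸ contDiff_radialSlope ha z₀ e
  let Ψ : E × C(unitInterval, ℝ) → E × C(unitInterval, ℝ) := fun p ↦ (p.1, radialMap f z₀ ℓ e p)
  have hΨ : ContDiff ℝ ∞ Ψ := contDiff_fst.prodMk (contDiff_radialMap hf z₀ ℓ e)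
  have hz : ∀ γ : C(unitInterval, ℝ), radialMap f z₀ ℓ e (z₀, γ) = γ := by
    intro γ
    have : f.comp (curveOf z₀ ℓ e (z₀, γ)) = 0 := by
      ext s
      simp [hfa, radialSlope, curveOf_apply]
    simp [radialMap, this]
  let D := fderiv ℝ (radialMap f z₀ ℓ e) (z₀, 0)
  have hD : HasFDerivAt (radialMap f z₀ ℓ e) D (z₀, 0) :=
    ((contDiff_radialMap hf z₀ ℓ e).differentiable (by simp) _).hasFDerivAt
  have hDinr : ∀ δ, D (0, δ) = δ := by
    intro δ
    have h1 := hD.comp (0 : C(unitInterval, ℝ)) (hasFDerivAt_prodMk_right z₀ 0)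
    have h2 : HasFDerivAt (fun γ : C(unitInterval, ℝ) ↦ γ)
        (D.comp (ContinuousLinearMap.inr ℝ E C(unitInterval, ℝ))) 0 := by
      simpa [Function.comp_def, hz] using! h1
    exact congrArg (fun A ↦ A δ) (h2.unique (hasFDerivAt_id _))
  have hDsplit : ∀ u δ, D (u, δ) = D (u, 0) + δ := by
    intro u δ
    rw [← hDinr δ, ← map_add, hDinr]
    simp
  let Ψ' : (E × C(unitInterval, ℝ)) ≃L[ℝ] (E × C(unitInterval, ℝ)) :=
    ContinuousLinearEquiv.equivOfInverse
      ((ContinuousLinearMap.fst ℝ E C(unitInterval, ℝ)).prod D)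
      ((ContinuousLinearMap.fst ℝ E C(unitInterval, ℝ)).prod
        (ContinuousLinearMap.snd ℝ E C(unitInterval, ℝ) -
          (D.comp (ContinuousLinearMap.inl ℝ E C(unitInterval, ℝ))).comp
            (ContinuousLinearMap.fst ℝ E C(unitInterval, ℝ))))
      (fun p ↦ by
        refine Prod.ext rfl ?_
        change D p - D (p.1, 0) = p.2
        rw [show D p = _ from hDsplit p.1 p.2]
        abel)
      (fun p ↦ by
        refine Prod.ext rfl ?_
        change D (p.1, p.2 - D (p.1, 0)) = p.2
        rw [hDsplit]
        abel)
  have hΨ' : HasFDerivAt Ψ (Ψ' : E × C(unitInterval, ℝ) →L[ℝ] E × C(unitInterval, ℝ)) (z₀, 0) :=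
    hasFDerivAt_fst.prodMk hD
  obtain ⟨φ, hφs, -, hφ, hφsymm⟩ := exists_openPartialHomeomorph_contDiffOn isOpen_univ
    hΨ.contDiffOn (mem_univ _) Ψ' hΨ'
  have hΨ0 : φ (z₀, 0) = (z₀, 0) := by rw [hφ]; exact Prod.ext rfl (hz 0)
  have hinc : ContDiff ℝ ∞ fun z : E ↦ (z, (0 : C(unitInterval, ℝ))) :=
    contDiff_id.prodMk contDiff_const
  refine ⟨(fun z ↦ (z, (0 : C(unitInterval, ℝ)))) ⁻¹' φ.target,
    φ.open_target.preimage hinc.continuous, ?_, fun z ↦ (φ.symm (z, 0)).2, ?_, ?_, ?_⟩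
  · change (z₀, 0) ∈ φ.target
    rw [← hΨ0]
    exact φ.map_source hφs
  · exact contDiff_snd.comp_contDiffOn (hφsymm.comp hinc.contDiffOn fun z hz ↦ hz)
  · change (φ.symm (z₀, 0)).2 = 0
    rw [← hΨ0, φ.left_inv hφs]
  · intro z hz
    have h1 : Ψ (φ.symm (z, 0)) = (z, 0) := by rw [← hφ]; exact φ.right_inv hz
    have h2 : (φ.symm (z, 0)).1 = z := congrArg Prod.fst h1
    have h3 : radialMap f z₀ ℓ e (φ.symm (z, 0)) = 0 := congrArg Prod.snd h1
    rwa [← h2, show ((φ.symm (z, 0)).1, (φ.symm ((φ.symm (z, 0)).1, 0)).2) = φ.symm (z, 0) by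
      rw [h2]; exact Prod.ext h2.symm rfl]

end RadialEquation

/-! ### The Frobenius theorem for hyperplanes in a vector space -/

section Frobenius

variable {E : Type} [NormedAddCommGroup E] [NormedSpace ℝ E]

/-- The uniqueness argument behind the Frobenius theorem: along a solution of the radial equation,
`Z` being a solution of the linearised equation, `W = Z - (1 - s) a(c(s)) v` solves a homogeneous
linear equation as soon as the integrability condition holds along the curve `c`. -/
theorem radial_variation_eq_zero {a : E → E →L[ℝ] ℝ} (ha : ContDiff ℝ ∞ a) {z₀ e h v : E}
    {Y Z : ℝ → ℝ}
    (hY : ∀ s ∈ Icc (0 : ℝ) 1, HasDerivAt Y (-radialSlope a z₀ e (s, h, Y s)) s)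
    (hZ : ∀ s ∈ Icc (0 : ℝ) 1, HasDerivAt Z
      (-(fderiv ℝ a (radialPoint z₀ e (s, h, Y s)) ((1 - s) • v + Z s • e) h +
        a (radialPoint z₀ e (s, h, Y s)) v)) s)
    (h0 : Z 0 = a (radialPoint z₀ e (0, h, Y 0)) v)
    (hint : ∀ s ∈ Icc (0 : ℝ) 1,
      fderiv ℝ a (radialPoint z₀ e (s, h, Y s)) (v + a (radialPoint z₀ e (s, h, Y s)) v • e) h =
      fderiv ℝ a (radialPoint z₀ e (s, h, Y s)) (h + a (radialPoint z₀ e (s, h, Y s)) h • e) v) :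
    Z 1 = 0 := by
  set c : ℝ → E := fun s ↦ radialPoint z₀ e (s, h, Y s) with hc
  have hcder : ∀ s ∈ Icc (0 : ℝ) 1, HasDerivAt c (-(h + a (c s) h • e)) s := by
    intro s hs
    have h1 : HasDerivAt (fun s : ℝ ↦ (1 - s) • h) (-h) s := by
      simpa using ((hasDerivAt_id s).const_sub 1).smul_const h
    have h2 := (h1.const_add z₀).add ((hY s hs).smul_const e)
    convert! h2 using 1
    simp only [radialSlope, hc, neg_smul]
    abel
  have hacder : ∀ s ∈ Icc (0 : ℝ) 1, HasDerivAt (fun s ↦ a (c s) v)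
      (-fderiv ℝ a (c s) (h + a (c s) h • e) v) s := by
    intro s hs
    have h1 := ((ha.differentiable (by simp) (c s)).hasFDerivAt.comp_hasDerivAt s
      (hcder s hs)).clm_apply (hasDerivAt_const s v)
    simpa [Function.comp_def] using! h1
  have hccont : ContinuousOn c (Icc 0 1) := fun s hs ↦ (hcder s hs).continuousAt.continuousWithinAt
  have hbcont : ContinuousOn (fun s ↦ fderiv ℝ a (c s) e h) (Icc 0 1) :=
    (((ha.continuous_fderiv (by simp)).comp_continuousOn hccont).clm_apply
      continuousOn_const).clm_apply continuousOn_const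
  obtain ⟨C, hC⟩ := isCompact_Icc.exists_bound_of_continuousOn hbcont
  have hWder : ∀ s ∈ Icc (0 : ℝ) 1, HasDerivAt (fun s ↦ Z s - (1 - s) * a (c s) v)
      (-(fderiv ℝ a (c s) e h * (Z s - (1 - s) * a (c s) v))) s := by
    intro s hs
    have h1 := (hZ s hs).sub (((hasDerivAt_id s).const_sub 1).mul (hacder s hs))
    convert! h1 using 1
    have h2 := hint s hs
    simp only [map_add, map_smul, add_apply, smul_apply,
      smul_eq_mul, id_eq] at h2 ⊢
    linear_combination (1 - s) * h2
  have hW := eq_zero_of_abs_deriv_le_mul_abs_self_of_eq_zero_right (K := C) (a := 0) (b := 1)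
    (fun s hs ↦ (hWder s hs).continuousAt.continuousWithinAt)
    (fun s hs ↦ (hWder s (Ico_subset_Icc_self hs)).hasDerivWithinAt)
    (by simp [h0, hc]) (fun s hs ↦ by
      rw [norm_neg, norm_mul]
      exact mul_le_mul_of_nonneg_right (hC s (Ico_subset_Icc_self hs)) (norm_nonneg _))
    1 (right_mem_Icc.2 zero_le_one)
  simpa using hW

/-- A solution of the integral equation `γ = c - ∫ β` on `[0, 1]` extends to a function on the line
satisfying the differential equation on `[0, 1]`. -/
theorem hasDerivAt_of_eq_sub_primitive {β : C(unitInterval, ℝ)} (c : ℝ) {s : ℝ}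
    (hs : s ∈ Icc (0 : ℝ) 1) :
    HasDerivAt (fun s : ℝ ↦ c - ∫ σ in (0 : ℝ)..s, β (projIcc 0 1 zero_le_one σ))
      (-β ⟨s, hs⟩) s := by
  have hcont : Continuous fun σ : ℝ ↦ β (projIcc 0 1 zero_le_one σ) := by fun_prop
  have := (intervalIntegral.integral_hasDerivAt_right (hcont.intervalIntegrable 0 s)
    (hcont.stronglyMeasurableAtFilter _ _) hcont.continuousAt).const_sub c
  rwa [projIcc_of_mem zero_le_one hs] at this

/-- The Frobenius theorem for the distribution `{v + a(z)(v) e | ℓ v = 0}` of hyperplanes. -/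
theorem exists_firstIntegral_of_contDiff [CompleteSpace E] {a : E → E →L[ℝ] ℝ}
    (ha : ContDiff ℝ ∞ a) {z₀ e : E} {ℓ : E →L[ℝ] ℝ} (hℓ : ℓ e = 1)
    (hint : ∀ᶠ z in 𝓝 z₀, ∀ v w, ℓ v = 0 → ℓ w = 0 →
      fderiv ℝ a z (v + a z v • e) w = fderiv ℝ a z (w + a z w • e) v) :
    ∃ U : Set E, IsOpen U ∧ z₀ ∈ U ∧ ∃ t : E → ℝ, ContDiffOn ℝ ∞ t U ∧ fderiv ℝ t z₀ e = 1 ∧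
      ∀ z ∈ U, ∀ v, ℓ v = 0 → fderiv ℝ t z (v + a z v • e) = 0 := by
  let f : C(ℝ × E × ℝ, ℝ) := ⟨radialSlope a z₀ e, (contDiff_radialSlope ha z₀ e).continuous⟩
  have hf : ContDiff ℝ ∞ f := contDiff_radialSlope ha z₀ e
  obtain ⟨U, hU, hz₀U, γ, hγ, hγ0, hγeq⟩ := exists_radialSolution ha z₀ ℓ e f rfl
  obtain ⟨r, hr, hball⟩ := Metric.eventually_nhds_iff_ball.1 hint
  have hγd : ∀ z ∈ U, HasFDerivAt γ (fderiv ℝ γ z) z := fun z hz ↦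
    ((hγ.contDiffAt (hU.mem_nhds hz)).differentiableAt (by simp)).hasFDerivAt
  -- The linearised equation, obtained by differentiating the equation for `γ` in `z`.
  have hlin : ∀ z ∈ U, ∀ u, fderiv ℝ γ z u = ℓ u • (1 : C(unitInterval, ℝ)) -
      primitive ⟨fun s ↦ fderiv ℝ f (curveOf z₀ ℓ e (z, γ z) s)
        (0, projAlong ℓ e u, fderiv ℝ γ z u s), by
        have := hf.continuous_fderiv (by simp); fun_prop⟩ := by
    intro z hz u
    have h1 := (((contDiff_radialMap hf z₀ ℓ e).differentiable (by simp)
      (z, γ z)).hasFDerivAt).comp z ((hasFDerivAt_id z).prodMk (hγd z hz))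
    have h2 : HasFDerivAt (fun _ : E ↦ (0 : C(unitInterval, ℝ))) _ z :=
      h1.congr_of_eventuallyEq (by
        filter_upwards [hU.mem_nhds hz] with y hy
        exact (hγeq y hy).symm)
    have h3 := congrArg (fun A ↦ A u) (h2.unique (hasFDerivAt_const _ _))
    have h4 : fderiv ℝ (radialMap f z₀ ℓ e) (z, γ z) (u, fderiv ℝ γ z u) = 0 := h3
    rw [fderiv_radialMap_apply hf] at h4
    linear_combination (exp := 1) h4
  have heval : ∀ z ∈ U, ∀ u, fderiv ℝ (fun z ↦ γ z 1) z u = fderiv ℝ γ z u 1 := by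
    intro z hz u
    have := (ContinuousMap.evalCLM ℝ (1 : unitInterval)).hasFDerivAt.comp z (hγd z hz)
    exact congrArg (fun A ↦ A u) (this.fderiv)
  have hevalsmooth : ContDiffOn ℝ ∞ (fun z ↦ γ z 1) U :=
    (ContinuousMap.evalCLM ℝ (1 : unitInterval) :
      C(unitInterval, ℝ) →L[ℝ] ℝ).contDiff.comp_contDiffOn hγ
  -- `N z` bounds the distance from `z₀` to the points of the curve through `z`.
  let N : E → ℝ := fun z ↦ ‖projAlong ℓ e (z - z₀)‖ + ‖γ z‖ * ‖e‖
  have hN : ContinuousOn N U := by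
    refine ContinuousOn.add ?_ (hγ.continuousOn.norm.mul continuousOn_const)
    exact ((projAlong ℓ e).continuous.comp (continuous_id.sub continuous_const)).norm.continuousOn
  refine ⟨U ∩ N ⁻¹' Iio r, hN.isOpen_inter_preimage hU isOpen_Iio, ⟨hz₀U, by simp [N, hγ0, hr]⟩,
    fun z ↦ γ z 1, hevalsmooth.mono inter_subset_left, ?_, ?_⟩
  · rw [heval z₀ hz₀U, hlin z₀ hz₀U]
    have hzero : ∀ s : unitInterval, fderiv ℝ f (curveOf z₀ ℓ e (z₀, γ z₀) s)
        (0, projAlong ℓ e e, fderiv ℝ γ z₀ e s) = 0 := by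
      intro s
      change fderiv ℝ (radialSlope a z₀ e) _ _ = 0
      rw [fderiv_radialSlope_apply ha, curveOf_apply]
      simp [hℓ]
    simp only [ContinuousMap.sub_apply, ContinuousMap.smul_apply, ContinuousMap.one_apply,
      primitive_apply, ContinuousMap.coe_mk, hzero, intervalIntegral.integral_zero, hℓ]
    simp
  · rintro z ⟨hzU, hzN⟩ v hv
    rw [heval z hzU]
    set u := v + a z v • e with hu
    have hℓu : ℓ u = a z v := by simp [hu, hv, hℓ]
    have hπu : projAlong ℓ e u = v := by simp [hu, hv, hℓ]
    set h := projAlong ℓ e (z - z₀) with hh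
    have hz : z₀ + h + ℓ (z - z₀) • e = z := by rw [hh, projAlong_apply]; abel
    let β : C(unitInterval, ℝ) := f.comp (curveOf z₀ ℓ e (z, γ z))
    let Y : ℝ → ℝ := fun s ↦ ℓ (z - z₀) - ∫ σ in (0 : ℝ)..s, β (projIcc 0 1 zero_le_one σ)
    have hYγ : ∀ s (hs : s ∈ Icc (0 : ℝ) 1), Y s = γ z ⟨s, hs⟩ := by
      intro s hs
      have h1 := congrArg (fun δ : C(unitInterval, ℝ) ↦ δ ⟨s, hs⟩) (hγeq z hzU)
      simp only [radialMap, ContinuousMap.add_apply, ContinuousMap.sub_apply,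
        ContinuousMap.smul_apply, ContinuousMap.one_apply, ContinuousMap.zero_apply,
        primitive_apply, smul_eq_mul, mul_one] at h1
      simp only [Y, β]
      linarith
    let β' : C(unitInterval, ℝ) := ⟨fun s ↦ fderiv ℝ f (curveOf z₀ ℓ e (z, γ z) s)
        (0, projAlong ℓ e u, fderiv ℝ γ z u s), by
        have := hf.continuous_fderiv (by simp); fun_prop⟩
    let Z : ℝ → ℝ := fun s ↦ ℓ u - ∫ σ in (0 : ℝ)..s, β' (projIcc 0 1 zero_le_one σ)
    have hZγ : ∀ s (hs : s ∈ Icc (0 : ℝ) 1), Z s = fderiv ℝ γ z u ⟨s, hs⟩ := by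
      intro s hs
      rw [hlin z hzU u]
      simp [Z, β', primitive_apply]
    have hcurve : ∀ s (hs : s ∈ Icc (0 : ℝ) 1),
        curveOf z₀ ℓ e (z, γ z) ⟨s, hs⟩ = (s, h, Y s) := by
      intro s hs
      rw [curveOf_apply, hYγ s hs]
    have h1mem : (1 : ℝ) ∈ Icc (0 : ℝ) 1 := right_mem_Icc.2 zero_le_one
    have hZ1 := hZγ 1 h1mem
    rw [show (⟨1, h1mem⟩ : unitInterval) = 1 from rfl] at hZ1
    rw [← hZ1]
    -- The derivative of `γ · 1` along the distribution vanishes by the variation argument, applied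
    -- to the curve `Y = γ z` and to its derivative `Z` in the direction `u`.
    refine radial_variation_eq_zero ha (z₀ := z₀) (e := e) (h := h) (v := v) (Y := Y) (Z := Z)
      ?_ ?_ ?_ ?_
    · intro s hs
      have := hasDerivAt_of_eq_sub_primitive (β := β) (ℓ (z - z₀)) hs
      rwa [show β ⟨s, hs⟩ = radialSlope a z₀ e (s, h, Y s) by
        rw [← hcurve s hs]; rfl] at this
    · intro s hs
      have := hasDerivAt_of_eq_sub_primitive (β := β') (ℓ u) hs
      rwa [show β' ⟨s, hs⟩ = fderiv ℝ a (radialPoint z₀ e (s, h, Y s)) ((1 - s) • v + Z s • e) h +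
          a (radialPoint z₀ e (s, h, Y s)) v by
        rw [hZγ s hs, ← fderiv_radialSlope_apply ha z₀ e (s, h, Y s) v, ← hcurve s hs, ← hπu]
        rfl] at this
    · have h1 : radialPoint z₀ e (0, h, Y 0) = z := by
        simpa [radialPoint, Y] using hz
      rw [h1]
      simp [Z, hℓu]
    · intro s hs
      refine hball _ ?_ v h hv ?_
      · rw [mem_ball_iff_norm]
        have h1 : ‖γ z ⟨s, hs⟩‖ ≤ ‖γ z‖ := (γ z).norm_coe_le_norm _
        calc ‖radialPoint z₀ e (s, h, Y s) - z₀‖ = ‖(1 - s) • h + Y s • e‖ := by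
              simp only [radialPoint]; congr 1; abel
          _ ≤ ‖(1 - s) • h‖ + ‖Y s • e‖ := norm_add_le _ _
          _ ≤ ‖h‖ + ‖γ z‖ * ‖e‖ := by
              rw [norm_smul, norm_smul, hYγ s hs]
              gcongr
              refine mul_le_of_le_one_left (norm_nonneg _) ?_
              rw [Real.norm_of_nonneg (by linarith [hs.2])]
              linarith [hs.1]
          _ < r := hzN
      · simp [hh, hℓ]

/-- **Frobenius theorem** for a 1-form on a vector space: if `η ∧ dη = 0` near a point where `η`
does not vanish, then near this point the kernels of `η` are those of an exact form `dt`. -/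
theorem exists_firstIntegral [CompleteSpace E] [HasContDiffBump E] {η : E → E →L[ℝ] ℝ} {U : Set E}
    (hU : IsOpen U) (hη : ContDiffOn ℝ ∞ η U) {z₀ : E} (hz₀ : z₀ ∈ U) (hη0 : η z₀ ≠ 0)
    (hint : ∀ z ∈ U, ∀ u v w, η z u * (fderiv ℝ η z v w - fderiv ℝ η z w v) +
      η z v * (fderiv ℝ η z w u - fderiv ℝ η z u w) +
      η z w * (fderiv ℝ η z u v - fderiv ℝ η z v u) = 0) :
    ∃ U' : Set E, IsOpen U' ∧ U' ⊆ U ∧ z₀ ∈ U' ∧ ∃ t : E → ℝ, ContDiffOn ℝ ∞ t U' ∧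
      ∀ z ∈ U', fderiv ℝ t z ≠ 0 ∧
        LinearMap.ker (η z).toLinearMap ≤ LinearMap.ker (fderiv ℝ t z).toLinearMap := by
  obtain ⟨e, he⟩ : ∃ e, η z₀ e ≠ 0 := by
    by_contra! h
    exact hη0 (ContinuousLinearMap.ext h)
  -- On `U₁` the hyperplane `ker η` is the graph of `-η / η(e)` over the kernel of `ℓ`.
  let U₁ : Set E := U ∩ (fun z ↦ η z e) ⁻¹' {0}ᶜ
  have hU₁ : IsOpen U₁ := (hη.continuousOn.clm_apply continuousOn_const).isOpen_inter_preimage hU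
    isOpen_compl_singleton
  have hηe : ContDiffOn ℝ ∞ (fun z ↦ η z e) U₁ :=
    (hη.mono inter_subset_left).clm_apply contDiffOn_const
  have hslope : ContDiffOn ℝ ∞ (fun z ↦ -((η z e)⁻¹ • η z)) U₁ :=
    ((hηe.inv fun z hz ↦ hz.2).smul (hη.mono inter_subset_left)).neg
  have hz₁ : z₀ ∈ U₁ := ⟨hz₀, he⟩
  obtain ⟨a, ha, haeq⟩ := exists_contDiff_eventuallyEq hU₁ hslope hz₁
  obtain ⟨O, hO, hOopen, hzO⟩ := eventually_nhds_iff.1 (haeq.eventually_nhds)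
  let ℓ : E →L[ℝ] ℝ := (η z₀ e)⁻¹ • η z₀
  have hℓ : ℓ e = 1 := by simp [ℓ, he]
  have hint' : ∀ᶠ z in 𝓝 z₀, ∀ v w, ℓ v = 0 → ℓ w = 0 →
      fderiv ℝ a z (v + a z v • e) w = fderiv ℝ a z (w + a z w • e) v := by
    filter_upwards [hOopen.mem_nhds hzO, hU₁.mem_nhds hz₁] with z hzO hz₁ v w _ _
    have haz : a =ᶠ[𝓝 z] fun z ↦ -((η z e)⁻¹ • η z) := hO z hzO
    have hval := haz.eq_of_nhds
    have hηd : HasFDerivAt η (fderiv ℝ η z) z :=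
      ((hη.contDiffAt (hU.mem_nhds hz₁.1)).differentiableAt (by simp)).hasFDerivAt
    -- Differentiate the relation `η(e) a = -η`.
    have hrel : (fun z ↦ η z e • a z) =ᶠ[𝓝 z] fun z ↦ -η z := by
      filter_upwards [haz, hU₁.mem_nhds hz₁] with y hy hy₁
      rw [hy, smul_neg, smul_smul, mul_inv_cancel₀ hy₁.2, one_smul]
    have h1 := ((hηd.clm_apply (hasFDerivAt_const e z)).smul
      (ha.differentiable (by simp) z).hasFDerivAt).congr_of_eventuallyEq hrel.symm
    have h2 := h1.unique hηd.neg
    have h3 : ∀ p q, η z e * fderiv ℝ a z p q + fderiv ℝ η z p e * a z q = - fderiv ℝ η z p q := by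
      intro p q
      have := congrArg (fun A ↦ A p q) h2
      simpa using this
    have h4 : ∀ q, η z e * a z q = - η z q := by
      intro q
      have := congrArg (fun A ↦ A q) hrel.eq_of_nhds
      simpa using this
    have he' : η z e ≠ 0 := hz₁.2
    have h5 := hint z hz₁.1 e v w
    have key : η z e ^ 2 *
        (fderiv ℝ a z (v + a z v • e) w - fderiv ℝ a z (w + a z w • e) v) = 0 := by
      simp only [map_add, map_smul, add_apply, smul_apply,
        smul_eq_mul]
      linear_combination η z e * h3 v w - η z e * h3 w v + (η z e * a z v) * h3 e w -
        (η z e * a z w) * h3 e v - h5 + (fderiv ℝ η z e v) * h4 w  - fderiv ℝ η z e w * h4 v +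
        fderiv ℝ η z w e * h4 v - fderiv ℝ η z v e * h4 w
    have := (mul_eq_zero.1 key).resolve_left (pow_ne_zero _ he')
    linarith
  obtain ⟨U₂, hU₂, hz₂, t, ht, ht0, hker⟩ := exists_firstIntegral_of_contDiff ha hℓ hint'
  let U₃ : Set E := U₂ ∩ fderiv ℝ t ⁻¹' {0}ᶜ
  have hU₃ : IsOpen U₃ := (ht.continuousOn_fderiv_of_isOpen hU₂ (by simp)).isOpen_inter_preimage hU₂
    isOpen_compl_singleton
  refine ⟨U₃ ∩ (O ∩ U₁), hU₃.inter (hOopen.inter hU₁), fun z hz ↦ hz.2.2.1,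
    ⟨⟨hz₂, fun h ↦ ?_⟩, hzO, hz₁⟩, t, ht.mono fun z hz ↦ hz.1.1, ?_⟩
  · rw [h] at ht0
    simp at ht0
  · rintro z ⟨⟨hz₂, hz₃⟩, hzO, hz₁⟩
    refine ⟨hz₃, fun u hu ↦ ?_⟩
    have hu' : η z u = 0 := hu
    have he' : η z e ≠ 0 := hz₁.2
    have hval := Filter.EventuallyEq.eq_of_nhds (hO z hzO)
    have h1 : ℓ (u - ℓ u • e) = 0 := by simp [hℓ]
    have h2 := hker z hz₂ _ h1
    rw [hval] at h2
    have h3 : (-((η z e)⁻¹ • η z)) (u - ℓ u • e) = ℓ u := by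
      simp [hu']
      field_simp
    rw [h3, sub_add_cancel] at h2
    exact h2

end Frobenius

/-! ### Straightening a first integral -/

section Straightening

variable {n : ℕ}

/-- A non-zero linear form is the last coordinate of a linear automorphism. -/
theorem exists_linearEquiv_last_eq {α : EuclideanSpace ℝ (Fin (n + 1)) →L[ℝ] ℝ} (hα : α ≠ 0) :
    ∃ L : EuclideanSpace ℝ (Fin (n + 1)) ≃L[ℝ] EuclideanSpace ℝ (Fin (n + 1)),
      ∀ v, L v (Fin.last n) = α v := by
  let p : EuclideanSpace ℝ (Fin (n + 1)) →L[ℝ] ℝ := EuclideanSpace.proj (Fin.last n)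
  have hp : p.toLinearMap ≠ 0 := fun h ↦ by
    simpa [p] using LinearMap.congr_fun h (EuclideanSpace.single (Fin.last n) 1)
  have hα' : α.toLinearMap ≠ 0 := fun h ↦ hα (ContinuousLinearMap.coe_injective h)
  have hdim : Module.finrank ℝ (LinearMap.ker α.toLinearMap) =
      Module.finrank ℝ (LinearMap.ker p.toLinearMap) := by
    have h1 := Module.Dual.finrank_ker_add_one_of_ne_zero hα'
    have h2 := Module.Dual.finrank_ker_add_one_of_ne_zero hp
    omega
  let K := LinearEquiv.ofFinrankEq _ _ hdim
  obtain ⟨u, hu⟩ : ∃ u, α u = 1 := by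
    obtain ⟨u, hu⟩ : ∃ u, α u ≠ 0 := by
      by_contra! h
      exact hα (ContinuousLinearMap.ext h)
    exact ⟨(α u)⁻¹ • u, by simp [hu]⟩
  let R : EuclideanSpace ℝ (Fin (n + 1)) →ₗ[ℝ] LinearMap.ker α.toLinearMap :=
    (LinearMap.id - α.toLinearMap.smulRight u).codRestrict _ (fun v ↦ by simp [hu])
  let L : EuclideanSpace ℝ (Fin (n + 1)) →ₗ[ℝ] EuclideanSpace ℝ (Fin (n + 1)) :=
    (Submodule.subtype _).comp (K.toLinearMap.comp R) +
      α.toLinearMap.smulRight (EuclideanSpace.single (Fin.last n) 1)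
  have hL : ∀ v, L v (Fin.last n) = α v := by
    intro v
    have : p (K (R v)) = 0 := (K (R v)).2
    have h2 : (K (R v) : EuclideanSpace ℝ (Fin (n + 1))) (Fin.last n) = 0 := this
    simp [L, h2]
  have hinj : Function.Injective L := by
    rw [injective_iff_map_eq_zero]
    intro v hv
    have h1 : α v = 0 := by rw [← hL v, hv]; rfl
    have h2 : (K (R v) : EuclideanSpace ℝ (Fin (n + 1))) = 0 := by
      simpa [L, h1] using hv
    have h3 : R v = 0 := by simpa using h2
    have h4 := congrArg Subtype.val h3
    have h5 : v - α v • u = 0 := h4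
    simpa [h1] using h5
  exact ⟨(LinearEquiv.ofInjectiveEndo L hinj).toContinuousLinearEquiv, hL⟩

/-- A local homeomorphism can be shrunk to one with convex image: the preimage of a ball. -/
theorem exists_convex_target {X E : Type*} [TopologicalSpace X] [NormedAddCommGroup E]
    [NormedSpace ℝ E] (φ : OpenPartialHomeomorph X E) {x : X} (hx : x ∈ φ.source) :
    ∃ ψ : OpenPartialHomeomorph X E, x ∈ ψ.source ∧ ψ.source ⊆ φ.source ∧ ψ.target ⊆ φ.target ∧
      Convex ℝ ψ.target ∧ ⇑ψ = φ ∧ ⇑ψ.symm = φ.symm := by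
  obtain ⟨r, hr, hball⟩ := Metric.isOpen_iff.1 φ.open_target _ (φ.map_source hx)
  refine ⟨(φ.symm.restrOpen (Metric.ball (φ x) r) Metric.isOpen_ball).symm,
    ⟨hx, Metric.mem_ball_self hr⟩, fun z hz ↦ hz.1, fun z hz ↦ hz.1, ?_, rfl, rfl⟩
  change Convex ℝ (φ.target ∩ Metric.ball (φ x) r)
  rw [inter_eq_right.2 hball]
  exact convex_ball _ _

/-- A function without critical point is the last coordinate of a local diffeomorphism with convex
image. -/
theorem exists_straightening {t : EuclideanSpace ℝ (Fin (n + 1)) → ℝ}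
    {U : Set (EuclideanSpace ℝ (Fin (n + 1)))} (hU : IsOpen U) (ht : ContDiffOn ℝ ∞ t U)
    {z₀ : EuclideanSpace ℝ (Fin (n + 1))} (hz₀ : z₀ ∈ U) (hd : fderiv ℝ t z₀ ≠ 0) :
    ∃ φ : OpenPartialHomeomorph (EuclideanSpace ℝ (Fin (n + 1))) (EuclideanSpace ℝ (Fin (n + 1))),
      z₀ ∈ φ.source ∧ φ.source ⊆ U ∧ ContDiffOn ℝ ∞ φ φ.source ∧
      ContDiffOn ℝ ∞ φ.symm φ.target ∧ Convex ℝ φ.target ∧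
      ∀ z, φ z (Fin.last n) = t z := by
  obtain ⟨L, hL⟩ := exists_linearEquiv_last_eq hd
  -- The last coordinate of `f` is `t`, and its derivative at `z₀` is the invertible map `L`.
  let f : EuclideanSpace ℝ (Fin (n + 1)) → EuclideanSpace ℝ (Fin (n + 1)) := fun z ↦
    L z + (t z - fderiv ℝ t z₀ z) • EuclideanSpace.single (Fin.last n) (1 : ℝ)
  have hf : ContDiffOn ℝ ∞ f U := L.contDiff.contDiffOn.add
    ((ht.sub (fderiv ℝ t z₀).contDiff.contDiffOn).smul contDiffOn_const)
  have hf' : HasFDerivAt f (L : EuclideanSpace ℝ (Fin (n + 1)) →L[ℝ] _) z₀ := by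
    have h1 : HasFDerivAt t (fderiv ℝ t z₀) z₀ :=
      ((ht.contDiffAt (hU.mem_nhds hz₀)).differentiableAt (by simp)).hasFDerivAt
    have h2 := L.hasFDerivAt.add ((h1.sub (fderiv ℝ t z₀).hasFDerivAt).smul_const
      (EuclideanSpace.single (Fin.last n) (1 : ℝ))) (x := z₀)
    convert! h2 using 1
    ext v
    simp
  obtain ⟨φ, hφ₀, hφU, hφ, hφs⟩ := exists_openPartialHomeomorph_contDiffOn hU hf hz₀ L hf'
  obtain ⟨ψ, hψ₀, hψs, hψt, hψc, hψ, hψsymm⟩ := exists_convex_target φ hφ₀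
  refine ⟨ψ, hψ₀, hψs.trans hφU, ?_, ?_, hψc, ?_⟩
  · rw [hψ, hφ]
    exact hf.mono (hψs.trans hφU)
  · rw [hψsymm]
    exact hφs.mono hψt
  · intro z
    rw [hψ, hφ]
    simp [f, hL]

end Straightening

/-! ### Plaques and tangent spaces of foliated charts -/

theorem PlaqueCompatible.symm {n : ℕ} {V : Type*} [TopologicalSpace V]
    {φ ψ : OpenPartialHomeomorph V (EuclideanSpace ℝ (Fin (n + 1)))}
    (h : PlaqueCompatible φ ψ) : PlaqueCompatible ψ φ := by
  intro x hx
  obtain ⟨W, hW, h'⟩ := h x hx.symm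
  exact ⟨W, hW, fun y hy z hz ↦ (h' y hy z hz).symm⟩

section Plaques

variable {n : ℕ} {V : Type*} [TopologicalSpace V]
  [ChartedSpace (EuclideanSpace ℝ (Fin (n + 1))) V]

theorem Foliation.ext_charts {F G : Foliation n V} (h : F.charts = G.charts) : F = G := by
  cases F; cases G; congr

theorem mdifferentiable_of_mem_maximalAtlas [IsManifold (𝓡 (n + 1)) ∞ V]
    {φ : OpenPartialHomeomorph V (EuclideanSpace ℝ (Fin (n + 1)))}
    (hφ : φ ∈ IsManifold.maximalAtlas (𝓡 (n + 1)) ∞ V) :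
    φ.MDifferentiable (𝓡 (n + 1)) (𝓡 (n + 1)) :=
  ⟨(contMDiffOn_of_mem_maximalAtlas hφ).mdifferentiableOn (by simp),
    (contMDiffOn_symm_of_mem_maximalAtlas hφ).mdifferentiableOn (by simp)⟩

/-- The derivative of a chart at `x`, with values in the model vector space rather than in its
tangent space. -/
def chartDeriv (φ : OpenPartialHomeomorph V (EuclideanSpace ℝ (Fin (n + 1)))) (x : V) :
    TangentSpace (𝓡 (n + 1)) x →L[ℝ] EuclideanSpace ℝ (Fin (n + 1)) :=
  mfderiv (𝓡 (n + 1)) (𝓡 (n + 1)) φ x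

theorem chartDeriv_surjective [IsManifold (𝓡 (n + 1)) ∞ V]
    {φ : OpenPartialHomeomorph V (EuclideanSpace ℝ (Fin (n + 1)))}
    (hφ : φ ∈ IsManifold.maximalAtlas (𝓡 (n + 1)) ∞ V) {x : V} (hx : x ∈ φ.source) :
    Function.Surjective (chartDeriv φ x) :=
  (mdifferentiable_of_mem_maximalAtlas hφ).mfderiv_surjective hx

/-- The derivative of a function computed in a chart. -/
theorem hasFDerivAt_comp_symm [IsManifold (𝓡 (n + 1)) ∞ V]
    {φ : OpenPartialHomeomorph V (EuclideanSpace ℝ (Fin (n + 1)))}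
    (hφ : φ ∈ IsManifold.maximalAtlas (𝓡 (n + 1)) ∞ V) {t : V → ℝ} {x : V} (hx : x ∈ φ.source)
    (ht : MDifferentiableAt (𝓡 (n + 1)) 𝓘(ℝ, ℝ) t x) :
    DifferentiableAt ℝ (t ∘ φ.symm) (φ x) ∧
    ∀ v : TangentSpace (𝓡 (n + 1)) x, mfderiv (𝓡 (n + 1)) 𝓘(ℝ, ℝ) t x v =
      fderiv ℝ (t ∘ φ.symm) (φ x) (chartDeriv φ x v) := by
  have hd := mdifferentiable_of_mem_maximalAtlas hφ
  have h1 : MDifferentiableAt (𝓡 (n + 1)) 𝓘(ℝ, ℝ) (t ∘ φ.symm) (φ x) := by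
    refine MDifferentiableAt.comp (φ x) ?_ (hd.mdifferentiableAt_symm (φ.map_source hx))
    rwa [φ.left_inv hx]
  refine ⟨mdifferentiableAt_iff_differentiableAt.1 h1, fun v ↦ ?_⟩
  have h2 : t =ᶠ[𝓝 x] (t ∘ φ.symm) ∘ φ := by
    filter_upwards [φ.open_source.mem_nhds hx] with y hy
    simp [φ.left_inv hy]
  rw [h2.mfderiv_eq, mfderiv_comp x h1 (hd.mdifferentiableAt hx), mfderiv_eq_fderiv]
  rfl

theorem contMDiffOn_height [IsManifold (𝓡 (n + 1)) ∞ V]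
    {φ : OpenPartialHomeomorph V (EuclideanSpace ℝ (Fin (n + 1)))}
    (hφ : φ ∈ IsManifold.maximalAtlas (𝓡 (n + 1)) ∞ V) :
    ContMDiffOn (𝓡 (n + 1)) 𝓘(ℝ, ℝ) ∞ (height φ) φ.source :=
  (EuclideanSpace.proj (𝕜 := ℝ) (Fin.last n)).contMDiff.comp_contMDiffOn
    (contMDiffOn_of_mem_maximalAtlas hφ)

variable [IsManifold (𝓡 (n + 1)) ∞ V]
  {φ : OpenPartialHomeomorph V (EuclideanSpace ℝ (Fin (n + 1)))}

theorem mdifferentiableAt_height (hφ : φ ∈ IsManifold.maximalAtlas (𝓡 (n + 1)) ∞ V) {x : V}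
    (hx : x ∈ φ.source) : MDifferentiableAt (𝓡 (n + 1)) 𝓘(ℝ, ℝ) (height φ) x :=
  ((contMDiffOn_height hφ).contMDiffAt (φ.open_source.mem_nhds hx)).mdifferentiableAt (by simp)

theorem mfderiv_height_apply (hφ : φ ∈ IsManifold.maximalAtlas (𝓡 (n + 1)) ∞ V) {x : V}
    (hx : x ∈ φ.source) (v : TangentSpace (𝓡 (n + 1)) x) :
    mfderiv (𝓡 (n + 1)) 𝓘(ℝ, ℝ) (height φ) x v =
      chartDeriv φ x v (Fin.last n) := by
  rw [(hasFDerivAt_comp_symm hφ hx (mdifferentiableAt_height hφ hx)).2 v]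
  have : height φ ∘ φ.symm =ᶠ[𝓝 (φ x)] EuclideanSpace.proj (𝕜 := ℝ) (Fin.last n) := by
    filter_upwards [φ.open_target.mem_nhds (φ.map_source hx)] with y hy
    simp [height, φ.right_inv hy]
  rw [this.fderiv_eq, ContinuousLinearMap.fderiv]
  rfl

theorem mfderiv_height_ne_zero (hφ : φ ∈ IsManifold.maximalAtlas (𝓡 (n + 1)) ∞ V) {x : V}
    (hx : x ∈ φ.source) : mfderiv (𝓡 (n + 1)) 𝓘(ℝ, ℝ) (height φ) x ≠ 0 := by
  intro h
  obtain ⟨v, hv⟩ := chartDeriv_surjective hφ hx (EuclideanSpace.single (Fin.last n) (1 : ℝ))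
  have h1 := mfderiv_height_apply hφ hx v
  rw [h, hv] at h1
  have h2 : (0 : ℝ) = EuclideanSpace.single (Fin.last n) (1 : ℝ) (Fin.last n) := h1
  simp at h2

/-- The differential of a function which is constant on the plaques of `φ` vanishes on the tangent
spaces of the plaques. -/
theorem ker_mfderiv_height_le (hφ : φ ∈ IsManifold.maximalAtlas (𝓡 (n + 1)) ∞ V) {x : V}
    (hx : x ∈ φ.source) {t : V → ℝ} (ht : MDifferentiableAt (𝓡 (n + 1)) 𝓘(ℝ, ℝ) t x)
    (hconst : ∀ᶠ y in 𝓝 x, height φ y = height φ x → t y = t x) :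
    LinearMap.ker (mfderiv (𝓡 (n + 1)) 𝓘(ℝ, ℝ) (height φ) x).toLinearMap ≤
      LinearMap.ker (mfderiv (𝓡 (n + 1)) 𝓘(ℝ, ℝ) t x).toLinearMap := by
  intro v hv
  change mfderiv (𝓡 (n + 1)) 𝓘(ℝ, ℝ) (height φ) x v = 0 at hv
  change mfderiv (𝓡 (n + 1)) 𝓘(ℝ, ℝ) t x v = 0
  obtain ⟨hk, hkv⟩ := hasFDerivAt_comp_symm hφ hx ht
  rw [mfderiv_height_apply hφ hx] at hv
  rw [hkv]
  generalize chartDeriv φ x v = w at hv ⊢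
  have hw : w (Fin.last n) = 0 := hv
  have h1 : HasDerivAt (fun s : ℝ ↦ (t ∘ φ.symm) (φ x + s • w)) (fderiv ℝ (t ∘ φ.symm) (φ x) w) 0 :=
    hk.hasFDerivAt.hasLineDerivAt w
  have hline : Filter.Tendsto (fun s : ℝ ↦ φ x + s • w) (𝓝 0) (𝓝 (φ x)) := by
    have : Continuous fun s : ℝ ↦ φ x + s • w := by fun_prop
    simpa using this.tendsto 0
  have h2 : (fun s : ℝ ↦ (t ∘ φ.symm) (φ x + s • w)) =ᶠ[𝓝 0] fun _ ↦ t x := by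
    have hcont : Filter.Tendsto φ.symm (𝓝 (φ x)) (𝓝 x) := by
      simpa [φ.left_inv hx] using (φ.continuousAt_symm (φ.map_source hx)).tendsto
    filter_upwards [hline.eventually (hcont.eventually hconst),
      hline.eventually (φ.open_target.mem_nhds (φ.map_source hx))] with s hs hst
    refine hs ?_
    rw [height, φ.right_inv hst]
    simp [height, hw]
  exact h1.unique ((hasDerivAt_const (0 : ℝ) (t x)).congr_of_eventuallyEq h2)

/-- A function whose differential vanishes on the tangent spaces of the plaques of `φ` is locally
constant on the plaques. -/
theorem eventually_eq_of_height_eq (hφ : φ ∈ IsManifold.maximalAtlas (𝓡 (n + 1)) ∞ V) {x : V}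
    (hx : x ∈ φ.source) {t : V → ℝ}
    (ht : ∀ᶠ y in 𝓝 x, MDifferentiableAt (𝓡 (n + 1)) 𝓘(ℝ, ℝ) t y)
    (hker : ∀ᶠ y in 𝓝 x,
      LinearMap.ker (mfderiv (𝓡 (n + 1)) 𝓘(ℝ, ℝ) (height φ) y).toLinearMap ≤
        LinearMap.ker (mfderiv (𝓡 (n + 1)) 𝓘(ℝ, ℝ) t y).toLinearMap) :
    ∃ W ∈ 𝓝 x, ∀ y ∈ W, ∀ z ∈ W, height φ y = height φ z → t y = t z := by
  have hcont : Filter.Tendsto φ.symm (𝓝 (φ x)) (𝓝 x) := by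
    simpa [φ.left_inv hx] using (φ.continuousAt_symm (φ.map_source hx)).tendsto
  obtain ⟨r, hr, hball⟩ := Metric.eventually_nhds_iff_ball.1
    ((hcont.eventually (ht.and hker)).and (φ.open_target.mem_nhds (φ.map_source hx)))
  refine ⟨φ.source ∩ φ ⁻¹' Metric.ball (φ x) r,
    Filter.inter_mem (φ.open_source.mem_nhds hx)
      ((φ.continuousAt hx).preimage_mem_nhds (Metric.ball_mem_nhds _ hr)), ?_⟩
  rintro y ⟨hy, hyb⟩ z ⟨hz, hzb⟩ hyz
  -- In the chart, the segment from `y` to `z` is tangent to the plaque.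
  have hw : (φ z - φ y) (Fin.last n) = 0 := by
    have : φ y (Fin.last n) = φ z (Fin.last n) := hyz
    simp [this]
  have hder : ∀ s ∈ Icc (0 : ℝ) 1,
      HasDerivAt (fun s : ℝ ↦ (t ∘ φ.symm) (φ y + s • (φ z - φ y))) 0 s := by
    intro s hs
    have hmem : φ y + s • (φ z - φ y) ∈ Metric.ball (φ x) r :=
      (convex_ball (φ x) r).add_smul_sub_mem hyb hzb hs
    obtain ⟨⟨hd, hk⟩, htgt⟩ := hball _ hmem
    have hsrc := φ.map_target htgt
    obtain ⟨hkd, hkv⟩ := hasFDerivAt_comp_symm hφ hsrc hd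
    rw [φ.right_inv htgt] at hkd hkv
    obtain ⟨v, hv⟩ := chartDeriv_surjective hφ hsrc (φ z - φ y)
    have h1 : mfderiv (𝓡 (n + 1)) 𝓘(ℝ, ℝ) t (φ.symm (φ y + s • (φ z - φ y))) v = 0 := by
      refine hk ?_
      change mfderiv (𝓡 (n + 1)) 𝓘(ℝ, ℝ) (height φ) _ v = 0
      rw [mfderiv_height_apply hφ hsrc, hv]
      exact hw
    rw [hkv, hv] at h1
    have h2 : HasDerivAt (fun s : ℝ ↦ φ y + s • (φ z - φ y)) (φ z - φ y) s := by
      simpa using ((hasDerivAt_id s).smul_const (φ z - φ y)).const_add (φ y)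
    have h3 := hkd.hasFDerivAt.comp_hasDerivAt s h2
    have h4 : fderiv ℝ (t ∘ φ.symm) (φ y + s • (φ z - φ y)) (φ z - φ y) = 0 := h1
    rwa [h4] at h3
  have := constant_of_has_deriv_right_zero (a := 0) (b := 1)
    (fun s hs ↦ (hder s hs).continuousAt.continuousWithinAt)
    (fun s hs ↦ (hder s (Ico_subset_Icc_self hs)).hasDerivWithinAt) 1 (right_mem_Icc.2 zero_le_one)
  simp only [Function.comp_apply, one_smul, zero_smul, add_zero, add_sub_cancel,
    φ.left_inv hy, φ.left_inv hz] at this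
  exact this.symm

variable {ψ : OpenPartialHomeomorph V (EuclideanSpace ℝ (Fin (n + 1)))}

theorem PlaqueCompatible.ker_mfderiv_le (h : PlaqueCompatible φ ψ)
    (hφ : φ ∈ IsManifold.maximalAtlas (𝓡 (n + 1)) ∞ V)
    (hψ : ψ ∈ IsManifold.maximalAtlas (𝓡 (n + 1)) ∞ V) {x : V} (hx : x ∈ φ.source)
    (hx' : x ∈ ψ.source) :
    LinearMap.ker (mfderiv (𝓡 (n + 1)) 𝓘(ℝ, ℝ) (height φ) x).toLinearMap ≤
      LinearMap.ker (mfderiv (𝓡 (n + 1)) 𝓘(ℝ, ℝ) (height ψ) x).toLinearMap := by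
  obtain ⟨W, hW, h'⟩ := h x ⟨hx, hx'⟩
  refine ker_mfderiv_height_le hφ hx (mdifferentiableAt_height hψ hx') ?_
  filter_upwards [hW] with y hy
  exact (h' y hy x (mem_of_mem_nhds hW)).1

theorem PlaqueCompatible.ker_mfderiv_eq (h : PlaqueCompatible φ ψ)
    (hφ : φ ∈ IsManifold.maximalAtlas (𝓡 (n + 1)) ∞ V)
    (hψ : ψ ∈ IsManifold.maximalAtlas (𝓡 (n + 1)) ∞ V) {x : V} (hx : x ∈ φ.source)
    (hx' : x ∈ ψ.source) :
    LinearMap.ker (mfderiv (𝓡 (n + 1)) 𝓘(ℝ, ℝ) (height φ) x).toLinearMap =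
      LinearMap.ker (mfderiv (𝓡 (n + 1)) 𝓘(ℝ, ℝ) (height ψ) x).toLinearMap :=
  le_antisymm (h.ker_mfderiv_le hφ hψ hx hx') (h.symm.ker_mfderiv_le hψ hφ hx' hx)

/-- Two charts whose plaques have the same tangent spaces are compatible. -/
theorem plaqueCompatible_of_ker_mfderiv_eq (hφ : φ ∈ IsManifold.maximalAtlas (𝓡 (n + 1)) ∞ V)
    (hψ : ψ ∈ IsManifold.maximalAtlas (𝓡 (n + 1)) ∞ V)
    (h : ∀ x ∈ φ.source ∩ ψ.source,
      LinearMap.ker (mfderiv (𝓡 (n + 1)) 𝓘(ℝ, ℝ) (height φ) x).toLinearMap =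
        LinearMap.ker (mfderiv (𝓡 (n + 1)) 𝓘(ℝ, ℝ) (height ψ) x).toLinearMap) :
    PlaqueCompatible φ ψ := by
  intro x hx
  have hev : ∀ᶠ y in 𝓝 x, y ∈ φ.source ∩ ψ.source :=
    (φ.open_source.inter ψ.open_source).mem_nhds hx
  obtain ⟨W₁, hW₁, h₁⟩ := eventually_eq_of_height_eq hφ hx.1
    (hev.mono fun y hy ↦ mdifferentiableAt_height hψ hy.2) (hev.mono fun y hy ↦ (h y hy).le)
  obtain ⟨W₂, hW₂, h₂⟩ := eventually_eq_of_height_eq hψ hx.2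
    (hev.mono fun y hy ↦ mdifferentiableAt_height hφ hy.1) (hev.mono fun y hy ↦ (h y hy).ge)
  exact ⟨W₁ ∩ W₂, Filter.inter_mem hW₁ hW₂, fun y hy z hz ↦
    ⟨h₁ y hy.1 z hz.1, h₂ y hy.2 z hz.2⟩⟩

/-- The intersection defining the tangent space can be computed in a single foliated chart. -/
theorem Foliation.tangent_eq_ker (F : Foliation n V) (hφ : φ ∈ F.charts) {x : V}
    (hx : x ∈ φ.source) :
    F.tangent x = LinearMap.ker (mfderiv (𝓡 (n + 1)) 𝓘(ℝ, ℝ) (height φ) x).toLinearMap := by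
  refine le_antisymm (iInf₂_le_of_le φ hφ (iInf_le _ hx)) ?_
  refine le_iInf₂ fun ψ hψ ↦ le_iInf fun hx' ↦ ?_
  exact (F.compatible φ hφ ψ hψ).ker_mfderiv_le (F.smooth φ hφ) (F.smooth ψ hψ) hx hx'

end Plaques

/-! ### Covector fields in the preferred charts -/

section ExteriorDerivative

theorem extDeriv_ofSubsingleton {E : Type*} [NormedAddCommGroup E] [NormedSpace ℝ E]
    {η : E → E →L[ℝ] ℝ} {z : E} (hη : DifferentiableAt ℝ η z) (u v : E) :
    extDeriv (fun z ↦ ContinuousAlternatingMap.ofSubsingleton ℝ E ℝ (0 : Fin 1) (η z)) z ![u, v] =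
      fderiv ℝ η z u v - fderiv ℝ η z v u := by
  have hd : DifferentiableAt ℝ
      (fun z ↦ ContinuousAlternatingMap.ofSubsingleton ℝ E ℝ (0 : Fin 1) (η z)) z :=
    (ContinuousAlternatingMap.ofSubsingletonLIE (𝕜 := ℝ) (E := E) (F := ℝ)
      (0 : Fin 1)).differentiableAt.comp z hη
  rw [extDeriv_apply hd, Fin.sum_univ_two]
  have h : ∀ p q : E, fderiv ℝ (fun y ↦ η y q) z p = fderiv ℝ η z p q := fun p q ↦ by
    rw [fderiv_clm_apply hη (differentiableAt_const q)]
    simp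
  simp [h, Fin.removeNth, sub_eq_add_neg]

end ExteriorDerivative

section LocalForm

variable {n : ℕ} {V : Type*} [TopologicalSpace V]
  [ChartedSpace (EuclideanSpace ℝ (Fin (n + 1))) V]

/-- The local representative of a covector field in the preferred chart at `x`, as a field of
linear forms on the model space. -/
def localForm (θ : CovectorField n V) (x : V) (z : EuclideanSpace ℝ (Fin (n + 1))) :
    EuclideanSpace ℝ (Fin (n + 1)) →L[ℝ] ℝ :=
  (θ ((extChartAt (𝓡 (n + 1)) x).symm z)).comp
    (mfderiv 𝓘(ℝ, EuclideanSpace ℝ (Fin (n + 1))) (𝓡 (n + 1)) (extChartAt (𝓡 (n + 1)) x).symm z)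

theorem localRep_eq (θ : CovectorField n V) (x : V) :
    localRep θ x = fun z ↦ ContinuousAlternatingMap.ofSubsingleton ℝ
      (EuclideanSpace ℝ (Fin (n + 1))) ℝ (0 : Fin 1) (localForm θ x z) := rfl

variable [IsManifold (𝓡 (n + 1)) ∞ V]

variable (V) in
/-- The coordinate frame of the preferred chart at `x₀`, as an operator from the model space to the
tangent space at `y`. -/
def coordFrame (x₀ y : V) : EuclideanSpace ℝ (Fin (n + 1)) →L[ℝ] TangentSpace (𝓡 (n + 1)) y :=
  (trivializationAt (EuclideanSpace ℝ (Fin (n + 1))) (TangentSpace (𝓡 (n + 1))) x₀).symmL ℝ y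

theorem coordFrame_symm {x₀ : V} {z : EuclideanSpace ℝ (Fin (n + 1))}
    (hz : z ∈ (extChartAt (𝓡 (n + 1)) x₀).target) :
    coordFrame V x₀ ((extChartAt (𝓡 (n + 1)) x₀).symm z) =
      mfderiv 𝓘(ℝ, EuclideanSpace ℝ (Fin (n + 1))) (𝓡 (n + 1))
        (extChartAt (𝓡 (n + 1)) x₀).symm z := by
  have hs : (extChartAt (𝓡 (n + 1)) x₀).symm z ∈
      (chartAt (EuclideanSpace ℝ (Fin (n + 1))) x₀).source := by
    rw [← extChartAt_source (𝓡 (n + 1))]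
    exact (extChartAt (𝓡 (n + 1)) x₀).map_target hz
  have h1 := TangentBundle.symmL_trivializationAt (I := 𝓡 (n + 1)) hs
  have h2 : (fun z ↦ (mfderivWithin 𝓘(ℝ, EuclideanSpace ℝ (Fin (n + 1))) (𝓡 (n + 1))
      (extChartAt (𝓡 (n + 1)) x₀).symm (range (𝓡 (n + 1))) z : EuclideanSpace ℝ (Fin (n + 1)) →L[ℝ]
        EuclideanSpace ℝ (Fin (n + 1))))
      (extChartAt (𝓡 (n + 1)) x₀ ((extChartAt (𝓡 (n + 1)) x₀).symm z)) =
      (fun z ↦ (mfderivWithin 𝓘(ℝ, EuclideanSpace ℝ (Fin (n + 1))) (𝓡 (n + 1))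
      (extChartAt (𝓡 (n + 1)) x₀).symm (range (𝓡 (n + 1))) z : EuclideanSpace ℝ (Fin (n + 1)) →L[ℝ]
        EuclideanSpace ℝ (Fin (n + 1)))) z :=
    congrArg _ ((extChartAt (𝓡 (n + 1)) x₀).right_inv hz)
  rw [coordFrame]
  refine (h1.trans h2).trans ?_
  simp only [modelWithCornersSelf_coe, range_id, mfderivWithin_univ]
  rfl

theorem localForm_extChartAt (θ : CovectorField n V) {x₀ y : V}
    (hy : y ∈ (extChartAt (𝓡 (n + 1)) x₀).source) :
    localForm θ x₀ (extChartAt (𝓡 (n + 1)) x₀ y) = (θ y).comp (coordFrame V x₀ y) := by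
  have h : localForm θ x₀ (extChartAt (𝓡 (n + 1)) x₀ y) = _ :=
    congrArg (ContinuousLinearMap.comp _)
      (coordFrame_symm ((extChartAt (𝓡 (n + 1)) x₀).map_source hy)).symm
  rw [h, (extChartAt (𝓡 (n + 1)) x₀).left_inv hy]

variable (V) in
/-- The derivative at `y` of the preferred chart at `x₀`, with values in the model space. -/
def coordDeriv (x₀ y : V) : TangentSpace (𝓡 (n + 1)) y →L[ℝ] EuclideanSpace ℝ (Fin (n + 1)) :=
  mfderiv (𝓡 (n + 1)) 𝓘(ℝ, EuclideanSpace ℝ (Fin (n + 1))) (extChartAt (𝓡 (n + 1)) x₀) y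

theorem coordDeriv_eq {x₀ y : V} (hy : y ∈ (extChartAt (𝓡 (n + 1)) x₀).source) :
    coordDeriv V x₀ y = (trivializationAt (EuclideanSpace ℝ (Fin (n + 1)))
      (TangentSpace (𝓡 (n + 1))) x₀).continuousLinearMapAt ℝ y :=
  (TangentBundle.continuousLinearMapAt_trivializationAt (by rwa [extChartAt_source] at hy)).symm

theorem coordDeriv_coordFrame {x₀ y : V}
    (hy : y ∈ (extChartAt (𝓡 (n + 1)) x₀).source) (v : EuclideanSpace ℝ (Fin (n + 1))) :
    coordDeriv V x₀ y (coordFrame V x₀ y v) = v := by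
  rw [coordDeriv_eq hy, coordFrame]
  exact Trivialization.continuousLinearMapAt_symmL _ (by simpa using hy) v

theorem coordFrame_coordDeriv {x₀ y : V}
    (hy : y ∈ (extChartAt (𝓡 (n + 1)) x₀).source) (v : TangentSpace (𝓡 (n + 1)) y) :
    coordFrame V x₀ y (coordDeriv V x₀ y v) = v := by
  rw [coordDeriv_eq hy, coordFrame]
  exact Trivialization.symmL_continuousLinearMapAt _ (by simpa using hy) v

theorem fderiv_transition_apply {x₀ x : V} {z : EuclideanSpace ℝ (Fin (n + 1))}
    (hz : z ∈ (extChartAt (𝓡 (n + 1)) x₀).target)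
    (hzx : (extChartAt (𝓡 (n + 1)) x₀).symm z ∈ (extChartAt (𝓡 (n + 1)) x).source)
    (v : EuclideanSpace ℝ (Fin (n + 1))) :
    fderiv ℝ (extChartAt (𝓡 (n + 1)) x ∘ (extChartAt (𝓡 (n + 1)) x₀).symm) z v =
      coordDeriv V x ((extChartAt (𝓡 (n + 1)) x₀).symm z)
        (coordFrame V x₀ ((extChartAt (𝓡 (n + 1)) x₀).symm z) v) := by
  have h1 : MDifferentiableAt (𝓡 (n + 1)) 𝓘(ℝ, EuclideanSpace ℝ (Fin (n + 1)))
      (extChartAt (𝓡 (n + 1)) x) ((extChartAt (𝓡 (n + 1)) x₀).symm z) :=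
    mdifferentiableAt_extChartAt (by rwa [extChartAt_source] at hzx)
  have h2 : MDifferentiableAt 𝓘(ℝ, EuclideanSpace ℝ (Fin (n + 1))) (𝓡 (n + 1))
      (extChartAt (𝓡 (n + 1)) x₀).symm z :=
    ((contMDiffOn_extChartAt_symm (n := ∞) x₀).contMDiffAt
      ((isOpen_extChartAt_target x₀).mem_nhds hz)).mdifferentiableAt (by simp)
  have h3 := mfderiv_comp z h1 h2
  rw [mfderiv_eq_fderiv] at h3
  rw [coordFrame_symm hz]
  exact congrArg (fun A : EuclideanSpace ℝ (Fin (n + 1)) →L[ℝ] EuclideanSpace ℝ (Fin (n + 1)) ↦ A v)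
    h3

/-- A covector field is a smooth section of the cotangent bundle at `x` exactly when its local
representative is smooth at the corresponding point of the model space. -/
theorem contMDiffAt_covector_iff (θ : CovectorField n V) {x₀ x : V}
    (hx : x ∈ (chartAt (EuclideanSpace ℝ (Fin (n + 1))) x₀).source) :
    ContMDiffAt (𝓡 (n + 1)) ((𝓡 (n + 1)).prod 𝓘(ℝ, EuclideanSpace ℝ (Fin (n + 1)) →L[ℝ] ℝ)) ∞
    (fun x : V ↦ TotalSpace.mk' (EuclideanSpace ℝ (Fin (n + 1)) →L[ℝ] ℝ)
      (E := fun x : V ↦ TangentSpace (𝓡 (n + 1)) x →L[ℝ] ℝ) x (θ x)) x ↔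
    ContDiffAt ℝ ∞ (localForm θ x₀) (extChartAt (𝓡 (n + 1)) x₀ x) := by
  have hE : ∀ y ∈ (chartAt (EuclideanSpace ℝ (Fin (n + 1))) x₀).source,
      ((trivializationAt (EuclideanSpace ℝ (Fin (n + 1)) →L[ℝ] ℝ)
        (fun x : V ↦ TangentSpace (𝓡 (n + 1)) x →L[ℝ] ℝ) x₀)
        (TotalSpace.mk' (EuclideanSpace ℝ (Fin (n + 1)) →L[ℝ] ℝ) y (θ y))).2 =
      localForm θ x₀ (extChartAt (𝓡 (n + 1)) x₀ y) := by
    intro y hy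
    rw [hom_trivializationAt_apply,
      localForm_extChartAt θ (by rwa [extChartAt_source])]
    ext v
    change (Bundle.Trivial.trivialization V ℝ).continuousLinearMapAt ℝ y
      (θ y (coordFrame V x₀ y v)) = _
    rw [Bundle.Trivial.continuousLinearMapAt_trivialization]
    rfl
  have hmem : x ∈ (trivializationAt (EuclideanSpace ℝ (Fin (n + 1)) →L[ℝ] ℝ)
        (fun x : V ↦ TangentSpace (𝓡 (n + 1)) x →L[ℝ] ℝ) x₀).baseSet := by
    simpa using hx
  rw [Trivialization.contMDiffAt_section_iff _ hmem]
  have hx' : x ∈ (extChartAt (𝓡 (n + 1)) x₀).source := by rwa [extChartAt_source]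
  have h1 : (fun y ↦ ((trivializationAt (EuclideanSpace ℝ (Fin (n + 1)) →L[ℝ] ℝ)
        (fun x : V ↦ TangentSpace (𝓡 (n + 1)) x →L[ℝ] ℝ) x₀)
        (TotalSpace.mk' (EuclideanSpace ℝ (Fin (n + 1)) →L[ℝ] ℝ) y (θ y))).2) =ᶠ[𝓝 x]
      fun y ↦ localForm θ x₀ (extChartAt (𝓡 (n + 1)) x₀ y) := by
    filter_upwards [(chartAt _ x₀).open_source.mem_nhds hx] with y hy using hE y hy
  rw [h1.contMDiffAt_iff, ← contMDiffAt_iff_contDiffAt]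
  constructor
  · intro h
    have h2 : ContMDiffAt 𝓘(ℝ, EuclideanSpace ℝ (Fin (n + 1))) (𝓡 (n + 1)) ∞
        (extChartAt (𝓡 (n + 1)) x₀).symm (extChartAt (𝓡 (n + 1)) x₀ x) :=
      (contMDiffOn_extChartAt_symm x₀).contMDiffAt
        ((isOpen_extChartAt_target x₀).mem_nhds ((extChartAt (𝓡 (n + 1)) x₀).map_source hx'))
    have h3 := ContMDiffAt.comp_of_eq h h2 ((extChartAt (𝓡 (n + 1)) x₀).left_inv hx')
    refine h3.congr_of_eventuallyEq ?_
    filter_upwards [(isOpen_extChartAt_target x₀).mem_nhds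
      ((extChartAt (𝓡 (n + 1)) x₀).map_source hx')] with z hz
    simp only [Function.comp_apply, (extChartAt (𝓡 (n + 1)) x₀).right_inv hz]
  · intro h
    exact h.comp x (contMDiffAt_extChartAt' hx)

/-- In the preferred charts, a 1-form transforms by pullback under the change of charts. -/
theorem localForm_eventuallyEq (θ : CovectorField n V) {x₀ x : V}
    (hx : x ∈ (extChartAt (𝓡 (n + 1)) x₀).source) :
    localForm θ x₀ =ᶠ[𝓝 (extChartAt (𝓡 (n + 1)) x₀ x)] fun z ↦
      (localForm θ x ((extChartAt (𝓡 (n + 1)) x ∘ (extChartAt (𝓡 (n + 1)) x₀).symm) z)).comp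
        (fderiv ℝ (extChartAt (𝓡 (n + 1)) x ∘ (extChartAt (𝓡 (n + 1)) x₀).symm) z) := by
  have hz := (extChartAt (𝓡 (n + 1)) x₀).map_source hx
  have hcont : ContinuousAt (extChartAt (𝓡 (n + 1)) x₀).symm (extChartAt (𝓡 (n + 1)) x₀ x) :=
    continuousAt_extChartAt_symm' hx
  have hnear := hcont.preimage_mem_nhds (by
    rw [(extChartAt (𝓡 (n + 1)) x₀).left_inv hx]
    exact extChartAt_source_mem_nhds (I := 𝓡 (n + 1)) x)
  filter_upwards [(isOpen_extChartAt_target x₀).mem_nhds hz, hnear] with z hz hzx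
  ext v
  rw [ContinuousLinearMap.comp_apply, fderiv_transition_apply hz hzx, Function.comp_apply,
    localForm_extChartAt θ hzx, ContinuousLinearMap.comp_apply, coordFrame_coordDeriv hzx,
    coordFrame_symm hz]
  rfl

end LocalForm

/-! ### The condition `θ ∧ dθ = 0` in charts -/

section Wedge

/-- The value of `η ∧ dη` on three vectors, for a 1-form `η` on a vector space. -/
def wedgeDeriv {E : Type*} [NormedAddCommGroup E] [NormedSpace ℝ E] (η : E → E →L[ℝ] ℝ)
    (z u v w : E) : ℝ :=
  η z u * (fderiv ℝ η z v w - fderiv ℝ η z w v) +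
    η z v * (fderiv ℝ η z w u - fderiv ℝ η z u w) +
    η z w * (fderiv ℝ η z u v - fderiv ℝ η z v u)

theorem wedgeDeriv_smul_fderiv {E : Type*} [NormedAddCommGroup E] [NormedSpace ℝ E]
    {η : E → E →L[ℝ] ℝ} {f t : E → ℝ} {z : E} (hf : DifferentiableAt ℝ f z)
    (ht : ContDiffAt ℝ ∞ t z) (h : η =ᶠ[𝓝 z] fun y ↦ f y • fderiv ℝ t y) (u v w : E) :
    wedgeDeriv η z u v w = 0 := by
  have ht' : DifferentiableAt ℝ (fderiv ℝ t) z :=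
    (ht.fderiv_right (m := ∞) (by simp)).differentiableAt (by simp)
  have hsymm : ∀ p q, fderiv ℝ (fderiv ℝ t) z p q = fderiv ℝ (fderiv ℝ t) z q p := fun p q ↦
    (ht.isSymmSndFDerivAt (by simpa using! (ENat.LEInfty.out : (2 : WithTop ℕ∞) ≤ ∞))).eq p q
  have hd : ∀ p q, fderiv ℝ η z p q =
      f z * fderiv ℝ (fderiv ℝ t) z p q + fderiv ℝ f z p * fderiv ℝ t z q := by
    intro p q
    rw [h.fderiv_eq, fderiv_fun_smul hf ht']
    simp
  have hv : ∀ p, η z p = f z * fderiv ℝ t z p := fun p ↦ by rw [h.eq_of_nhds]; simp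
  simp only [wedgeDeriv, hd, hv]
  rw [hsymm v u, hsymm w u, hsymm w v]
  ring

theorem eventually_extChartAt {n : ℕ} {V : Type*} [TopologicalSpace V]
    [ChartedSpace (EuclideanSpace ℝ (Fin (n + 1))) V] {x : V}
    {p : EuclideanSpace ℝ (Fin (n + 1)) → Prop}
    (h : ∀ᶠ y in 𝓝 x, p (extChartAt (𝓡 (n + 1)) x y)) :
    ∀ᶠ z in 𝓝 (extChartAt (𝓡 (n + 1)) x x), p z := by
  have hcont : Filter.Tendsto (extChartAt (𝓡 (n + 1)) x).symm (𝓝 (extChartAt (𝓡 (n + 1)) x x))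
      (𝓝 x) := by
    simpa using (continuousAt_extChartAt_symm (I := 𝓡 (n + 1)) x).tendsto
  filter_upwards [hcont.eventually h, extChartAt_target_mem_nhds (I := 𝓡 (n + 1)) x] with z hz hzt
  rwa [(extChartAt (𝓡 (n + 1)) x).right_inv hzt] at hz

variable {n : ℕ} {V : Type*} [TopologicalSpace V]
  [ChartedSpace (EuclideanSpace ℝ (Fin (n + 1))) V] [IsManifold (𝓡 (n + 1)) ∞ V]

/-- The covector field `θ`, as a section of the cotangent bundle, is smooth at `x`. -/
def SmoothFormAt (θ : CovectorField n V) (x : V) : Prop :=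
  ContMDiffAt (𝓡 (n + 1)) ((𝓡 (n + 1)).prod 𝓘(ℝ, EuclideanSpace ℝ (Fin (n + 1)) →L[ℝ] ℝ)) ∞
    (fun x : V ↦ TotalSpace.mk' (EuclideanSpace ℝ (Fin (n + 1)) →L[ℝ] ℝ)
      (E := fun x : V ↦ TangentSpace (𝓡 (n + 1)) x →L[ℝ] ℝ) x (θ x)) x

theorem SmoothFormOn.smoothFormAt {θ : CovectorField n V} {U : Set V} (h : SmoothFormOn θ U)
    {x : V} (hU : U ∈ 𝓝 x) : SmoothFormAt θ x :=
  h.contMDiffAt hU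

theorem smoothFormOn_of_forall {θ : CovectorField n V} {U : Set V}
    (h : ∀ x ∈ U, SmoothFormAt θ x) : SmoothFormOn θ U := fun x hx ↦ (h x hx).contMDiffWithinAt

theorem SmoothFormAt.congr {θ θ' : CovectorField n V} {x : V} (h : SmoothFormAt θ x)
    (h' : ∀ᶠ y in 𝓝 x, θ' y = θ y) : SmoothFormAt θ' x := by
  refine ContMDiffAt.congr_of_eventuallyEq h ?_
  filter_upwards [h'] with y hy
  rw [hy]

theorem SmoothFormAt.smul {θ : CovectorField n V} {x : V} (h : SmoothFormAt θ x) {f : V → ℝ}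
    (hf : ContMDiffAt (𝓡 (n + 1)) 𝓘(ℝ, ℝ) ∞ f x) : SmoothFormAt (fun y ↦ f y • θ y) x :=
  ContMDiffAt.smul_section hf h

theorem SmoothFormAt.contDiffAt {θ : CovectorField n V} {x₀ x : V} (h : SmoothFormAt θ x)
    (hx : x ∈ (extChartAt (𝓡 (n + 1)) x₀).source) :
    ContDiffAt ℝ ∞ (localForm θ x₀) (extChartAt (𝓡 (n + 1)) x₀ x) :=
  (contMDiffAt_covector_iff θ (by rwa [extChartAt_source] at hx)).1 h

theorem extDerivative_eq {θ : CovectorField n V} {x : V} (h : SmoothFormAt θ x)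
    (u v : TangentSpace (𝓡 (n + 1)) x) :
    extDerivative θ x u v =
      fderiv ℝ (localForm θ x) (extChartAt (𝓡 (n + 1)) x x) (coordDeriv V x x u)
        (coordDeriv V x x v) -
      fderiv ℝ (localForm θ x) (extChartAt (𝓡 (n + 1)) x x) (coordDeriv V x x v)
        (coordDeriv V x x u) :=
  extDeriv_ofSubsingleton ((h.contDiffAt (mem_extChartAt_source x)).differentiableAt (by simp)) _ _

theorem apply_eq_localForm (θ : CovectorField n V) (x : V) (u : TangentSpace (𝓡 (n + 1)) x) :
    θ x u = localForm θ x (extChartAt (𝓡 (n + 1)) x x) (coordDeriv V x x u) := by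
  rw [localForm_extChartAt θ (mem_extChartAt_source x), ContinuousLinearMap.comp_apply,
    coordFrame_coordDeriv (mem_extChartAt_source x)]

theorem wedgeExtDerivative_eq {θ : CovectorField n V} {x : V} (h : SmoothFormAt θ x)
    (u v w : TangentSpace (𝓡 (n + 1)) x) :
    wedgeExtDerivative θ x u v w = wedgeDeriv (localForm θ x) (extChartAt (𝓡 (n + 1)) x x)
      (coordDeriv V x x u) (coordDeriv V x x v) (coordDeriv V x x w) := by
  simp only [wedgeExtDerivative, wedgeDeriv, extDerivative_eq h, apply_eq_localForm θ x]

/-- The condition `θ ∧ dθ = 0` at `x` can be read in any preferred chart. -/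
theorem wedgeDeriv_localForm {θ : CovectorField n V} {x₀ x : V} (h : SmoothFormAt θ x)
    (hx : x ∈ (extChartAt (𝓡 (n + 1)) x₀).source) (u v w : EuclideanSpace ℝ (Fin (n + 1))) :
    wedgeDeriv (localForm θ x₀) (extChartAt (𝓡 (n + 1)) x₀ x) u v w =
      wedgeExtDerivative θ x (coordFrame V x₀ x u) (coordFrame V x₀ x v)
        (coordFrame V x₀ x w) := by
  set z := extChartAt (𝓡 (n + 1)) x₀ x with hz
  have hzx : (extChartAt (𝓡 (n + 1)) x₀).symm z = x := (extChartAt (𝓡 (n + 1)) x₀).left_inv hx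
  have hzt : z ∈ (extChartAt (𝓡 (n + 1)) x₀).target := (extChartAt (𝓡 (n + 1)) x₀).map_source hx
  let κ := extChartAt (𝓡 (n + 1)) x ∘ (extChartAt (𝓡 (n + 1)) x₀).symm
  have hκz : κ z = extChartAt (𝓡 (n + 1)) x x := congrArg _ hzx
  have hκ : ContDiffAt ℝ ∞ κ z := by
    rw [← contMDiffAt_iff_contDiffAt]
    refine ContMDiffAt.comp_of_eq (contMDiffAt_extChartAt (n := ∞) (x := x)) ?_ hzx
    exact (contMDiffOn_extChartAt_symm (n := ∞) x₀).contMDiffAt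
      ((isOpen_extChartAt_target x₀).mem_nhds hzt)
  have hd₀ : DifferentiableAt ℝ (localForm θ x₀) z := (h.contDiffAt hx).differentiableAt (by simp)
  have hd : DifferentiableAt ℝ (localForm θ x) (κ z) := by
    rw [hκz]
    exact (h.contDiffAt (mem_extChartAt_source x)).differentiableAt (by simp)
  have hκ' : ∀ p, fderiv ℝ κ z p = coordDeriv V x x (coordFrame V x₀ x p) := by
    intro p
    have h1 := fderiv_transition_apply hzt (by rw [hzx]; exact mem_extChartAt_source x) p
    rwa [hzx] at h1
  have hpull : localRep θ x₀ =ᶠ[𝓝 z] fun y ↦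
      (localRep θ x (κ y)).compContinuousLinearMap (fderiv ℝ κ y) := by
    filter_upwards [localForm_eventuallyEq θ hx] with y hy
    change ContinuousAlternatingMap.ofSubsingleton ℝ _ ℝ (0 : Fin 1) (localForm θ x₀ y) = _
    rw [hy]
    rfl
  have hd' : DifferentiableAt ℝ (localRep θ x) (κ z) :=
    (ContinuousAlternatingMap.ofSubsingletonLIE (𝕜 := ℝ) (E := EuclideanSpace ℝ (Fin (n + 1)))
      (F := ℝ) (0 : Fin 1)).differentiableAt.comp (κ z) hd
  have hext : ∀ p q, fderiv ℝ (localForm θ x₀) z p q - fderiv ℝ (localForm θ x₀) z q p =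
      extDerivative θ x (coordFrame V x₀ x p) (coordFrame V x₀ x q) := by
    intro p q
    rw [← extDeriv_ofSubsingleton hd₀, ← localRep_eq, hpull.extDeriv_eq,
      extDeriv_pullback hd' hκ (by simpa using! (ENat.LEInfty.out : (2 : WithTop ℕ∞) ≤ ∞)),
      extDerivative_eq h, ← extDeriv_ofSubsingleton (by
        rwa [hκz] at hd), ← localRep_eq, hκz,
      ContinuousAlternatingMap.compContinuousLinearMap_apply]
    congr 1
    ext i j
    fin_cases i <;> simp [hκ']
  have hval : ∀ p, localForm θ x₀ z p = θ x (coordFrame V x₀ x p) := fun p ↦ by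
    rw [hz, localForm_extChartAt θ hx, ContinuousLinearMap.comp_apply]
  simp only [wedgeDeriv, wedgeExtDerivative, hext, hval]

/-- The differential of a function as a covector field. -/
def differential (t : V → ℝ) : CovectorField n V := fun x ↦ mfderiv (𝓡 (n + 1)) 𝓘(ℝ, ℝ) t x

/-- The local representative of `dt` is the differential of the local representative of `t`. -/
theorem localForm_mfderiv {t : V → ℝ} {x₀ y : V}
    (hy : y ∈ (extChartAt (𝓡 (n + 1)) x₀).source)
    (ht : MDifferentiableAt (𝓡 (n + 1)) 𝓘(ℝ, ℝ) t y) :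
    localForm (differential t) x₀ (extChartAt (𝓡 (n + 1)) x₀ y) =
      fderiv ℝ (t ∘ (extChartAt (𝓡 (n + 1)) x₀).symm) (extChartAt (𝓡 (n + 1)) x₀ y) := by
  have hz := (extChartAt (𝓡 (n + 1)) x₀).map_source hy
  have h2 : MDifferentiableAt 𝓘(ℝ, EuclideanSpace ℝ (Fin (n + 1))) (𝓡 (n + 1))
      (extChartAt (𝓡 (n + 1)) x₀).symm (extChartAt (𝓡 (n + 1)) x₀ y) :=
    ((contMDiffOn_extChartAt_symm (n := ∞) x₀).contMDiffAt
      ((isOpen_extChartAt_target x₀).mem_nhds hz)).mdifferentiableAt (by simp)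
  have h3 := mfderiv_comp (extChartAt (𝓡 (n + 1)) x₀ y) (g := t) (I'' := 𝓘(ℝ, ℝ))
    (by rwa [(extChartAt (𝓡 (n + 1)) x₀).left_inv hy]) h2
  rw [mfderiv_eq_fderiv] at h3
  exact h3.symm

theorem contDiffAt_comp_extChartAt_symm {t : V → ℝ} {x₀ x : V}
    (hx : x ∈ (extChartAt (𝓡 (n + 1)) x₀).source) (ht : ContMDiffAt (𝓡 (n + 1)) 𝓘(ℝ, ℝ) ∞ t x) :
    ContDiffAt ℝ ∞ (t ∘ (extChartAt (𝓡 (n + 1)) x₀).symm) (extChartAt (𝓡 (n + 1)) x₀ x) := by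
  rw [← contMDiffAt_iff_contDiffAt]
  refine ContMDiffAt.comp_of_eq ht ?_ ((extChartAt (𝓡 (n + 1)) x₀).left_inv hx)
  exact (contMDiffOn_extChartAt_symm (n := ∞) x₀).contMDiffAt
    ((isOpen_extChartAt_target x₀).mem_nhds ((extChartAt (𝓡 (n + 1)) x₀).map_source hx))

theorem localForm_smul_mfderiv_eventuallyEq {θ : CovectorField n V} {f t : V → ℝ} {x : V}
    (ht : ∀ᶠ y in 𝓝 x, MDifferentiableAt (𝓡 (n + 1)) 𝓘(ℝ, ℝ) t y)
    (h : ∀ᶠ y in 𝓝 x, θ y = f y • differential t y) :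
    localForm θ x =ᶠ[𝓝 (extChartAt (𝓡 (n + 1)) x x)] fun z ↦
      (f ∘ (extChartAt (𝓡 (n + 1)) x).symm) z •
        fderiv ℝ (t ∘ (extChartAt (𝓡 (n + 1)) x).symm) z := by
  refine eventually_extChartAt ?_
  filter_upwards [ht, h, extChartAt_source_mem_nhds (I := 𝓡 (n + 1)) x] with y hy hθ hyx
  rw [← localForm_mfderiv hyx hy, localForm_extChartAt _ hyx, localForm_extChartAt _ hyx, hθ,
    Function.comp_apply, (extChartAt (𝓡 (n + 1)) x).left_inv hyx]
  rfl

/-- A multiple `f dt` of an exact form satisfies `θ ∧ dθ = 0`. -/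
theorem wedgeExtDerivative_eq_zero {θ : CovectorField n V} {f t : V → ℝ} {x : V}
    (hθ : SmoothFormAt θ x) (hf : ContMDiffAt (𝓡 (n + 1)) 𝓘(ℝ, ℝ) ∞ f x)
    (ht : ∀ᶠ y in 𝓝 x, ContMDiffAt (𝓡 (n + 1)) 𝓘(ℝ, ℝ) ∞ t y)
    (h : ∀ᶠ y in 𝓝 x, θ y = f y • differential t y)
    (u v w : TangentSpace (𝓡 (n + 1)) x) : wedgeExtDerivative θ x u v w = 0 := by
  rw [wedgeExtDerivative_eq hθ]
  exact wedgeDeriv_smul_fderiv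
    ((contDiffAt_comp_extChartAt_symm (mem_extChartAt_source x) hf).differentiableAt (by simp))
    (contDiffAt_comp_extChartAt_symm (mem_extChartAt_source x) ht.self_of_nhds)
    (localForm_smul_mfderiv_eventuallyEq (ht.mono fun y hy ↦ hy.mdifferentiableAt (by simp)) h)
    _ _ _

theorem smoothFormAt_mfderiv {t : V → ℝ} {x : V}
    (ht : ∀ᶠ y in 𝓝 x, ContMDiffAt (𝓡 (n + 1)) 𝓘(ℝ, ℝ) ∞ t y) :
    SmoothFormAt (differential (n := n) t) x := by
  refine (contMDiffAt_covector_iff _ (mem_chart_source _ x)).2 ?_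
  have h1 := localForm_smul_mfderiv_eventuallyEq (f := fun _ ↦ 1)
    (θ := fun y : V ↦ differential t y)
    (ht.mono fun y hy ↦ hy.mdifferentiableAt (by simp))
    (Filter.Eventually.of_forall fun y ↦ (one_smul ℝ _).symm)
  refine ContDiffAt.congr_of_eventuallyEq ?_ h1
  simp only [Function.comp_apply, one_smul]
  exact (contDiffAt_comp_extChartAt_symm (mem_extChartAt_source x) ht.self_of_nhds).fderiv_right
    (by simp)

end Wedge

/-! ### The foliation of an integrable form -/

theorem ker_eq_of_ker_le {T : Type*} [AddCommGroup T] [Module ℝ T] {α β : T →ₗ[ℝ] ℝ} (hβ : β ≠ 0)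
    (h : LinearMap.ker α ≤ LinearMap.ker β) : LinearMap.ker α = LinearMap.ker β := by
  refine le_antisymm h fun v hv ↦ ?_
  by_contra hαv
  have hv' : β v = 0 := hv
  have hαv' : α v ≠ 0 := hαv
  refine hβ (LinearMap.ext fun w ↦ ?_)
  -- Both `α` and `β` vanish on the component of `w` in `ker α` along `v`.
  have h1 : α (w - (α w / α v) • v) = 0 := by
    simp [div_mul_cancel₀ _ hαv']
  have h2 : β (w - (α w / α v) • v) = 0 := h h1
  simpa [hv'] using h2

section IntegralCharts

variable {n : ℕ} {V : Type*} [TopologicalSpace V]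
  [ChartedSpace (EuclideanSpace ℝ (Fin (n + 1))) V] [IsManifold (𝓡 (n + 1)) ∞ V]

theorem trans_mem_maximalAtlas {e : OpenPartialHomeomorph V (EuclideanSpace ℝ (Fin (n + 1)))}
    (he : e ∈ IsManifold.maximalAtlas (𝓡 (n + 1)) ∞ V)
    {χ : OpenPartialHomeomorph (EuclideanSpace ℝ (Fin (n + 1))) (EuclideanSpace ℝ (Fin (n + 1)))}
    (hχ : ContDiffOn ℝ ∞ χ χ.source) (hχ' : ContDiffOn ℝ ∞ χ.symm χ.target) :
    e.trans χ ∈ IsManifold.maximalAtlas (𝓡 (n + 1)) ∞ V := by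
  refine OpenPartialHomeomorph.mem_maximalAtlas_of_contMDiffOn _ ?_ ?_
  · rw [OpenPartialHomeomorph.coe_trans]
    refine ContMDiffOn.comp (t := χ.source) hχ.contMDiffOn
      ((contMDiffOn_of_mem_maximalAtlas he).mono ?_) ?_
    · intro x hx
      exact (OpenPartialHomeomorph.trans_source e χ ▸ hx).1
    · intro x hx
      exact (OpenPartialHomeomorph.trans_source e χ ▸ hx).2
  · rw [OpenPartialHomeomorph.coe_trans_symm]
    refine ContMDiffOn.comp (t := e.target) (contMDiffOn_symm_of_mem_maximalAtlas he)
      (hχ'.contMDiffOn.mono ?_) ?_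
    · intro x hx
      exact (OpenPartialHomeomorph.trans_target e χ ▸ hx).1
    · intro x hx
      exact (OpenPartialHomeomorph.trans_target e χ ▸ hx).2

/-- The Frobenius theorem on a manifold: around each point, an integrable form without zeros has a
chart whose plaques are tangent to its kernels. -/
theorem exists_chart_ker_eq {θ : CovectorField n V} (hθ : ∀ x, SmoothFormAt θ x)
    (hint : ∀ x, ∀ u v w : TangentSpace (𝓡 (n + 1)) x, wedgeExtDerivative θ x u v w = 0)
    (hne : ∀ x, θ x ≠ 0) (x₀ : V) :
    ∃ φ ∈ IsManifold.maximalAtlas (𝓡 (n + 1)) ∞ V, Convex ℝ φ.target ∧ x₀ ∈ φ.source ∧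
      ∀ y ∈ φ.source, LinearMap.ker (mfderiv (𝓡 (n + 1)) 𝓘(ℝ, ℝ) (height φ) y).toLinearMap =
        LinearMap.ker (θ y).toLinearMap := by
  let e := chartAt (EuclideanSpace ℝ (Fin (n + 1))) x₀
  have hes : (extChartAt (𝓡 (n + 1)) x₀).source = e.source := extChartAt_source (𝓡 (n + 1)) x₀
  have het : (extChartAt (𝓡 (n + 1)) x₀).target = e.target := by
    simp [e, mfld_simps]
  have hee : ⇑(extChartAt (𝓡 (n + 1)) x₀) = e := by simp [e, mfld_simps]
  have hees : ⇑(extChartAt (𝓡 (n + 1)) x₀).symm = e.symm := by simp [e, mfld_simps]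
  have hη : ContDiffOn ℝ ∞ (localForm θ x₀) e.target := by
    intro z hz
    have h1 := (hθ (e.symm z)).contDiffAt (x₀ := x₀) (by rw [hes]; exact e.map_target hz)
    rw [hee, e.right_inv hz] at h1
    exact h1.contDiffWithinAt
  have hη0 : localForm θ x₀ (e x₀) ≠ 0 := by
    intro h0
    refine hne x₀ (ContinuousLinearMap.ext fun v ↦ ?_)
    rw [apply_eq_localForm, hee, h0]
    rfl
  have hwedge : ∀ z ∈ e.target, ∀ u v w, wedgeDeriv (localForm θ x₀) z u v w = 0 := by
    intro z hz u v w
    have h1 := wedgeDeriv_localForm (hθ (e.symm z)) (x₀ := x₀)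
      (by rw [hes]; exact e.map_target hz) u v w
    rw [hee, e.right_inv hz] at h1
    rw [h1, hint]
  obtain ⟨U, hU, hUe, hx₀U, t, ht, hker⟩ := exists_firstIntegral e.open_target hη
    (e.map_source (mem_chart_source _ x₀)) hη0 hwedge
  obtain ⟨χ, hχ₀, hχU, hχ, hχ', hχc, hχt⟩ := exists_straightening hU ht hx₀U (hker _ hx₀U).1
  have hmem := trans_mem_maximalAtlas (IsManifold.chart_mem_maximalAtlas (I := 𝓡 (n + 1))
    (n := ∞) x₀) hχ hχ'
  refine ⟨e.trans χ, hmem, ?_, ?_, ?_⟩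
  · have : (e.trans χ).target = χ.target := by
      rw [OpenPartialHomeomorph.trans_target]
      exact inter_eq_left.2 fun z hz ↦ hUe (hχU (χ.map_target hz))
    rwa [this]
  · rw [OpenPartialHomeomorph.trans_source]
    exact ⟨mem_chart_source _ x₀, hχ₀⟩
  · intro y hy
    have hy' := hy
    rw [OpenPartialHomeomorph.trans_source] at hy'
    obtain ⟨hye, hyχ⟩ := hy'
    have hyx : y ∈ (extChartAt (𝓡 (n + 1)) x₀).source := by rwa [hes]
    have h1 := localForm_mfderiv hyx (mdifferentiableAt_height hmem hy)
    have h2 : height (e.trans χ) ∘ (extChartAt (𝓡 (n + 1)) x₀).symm =ᶠ[𝓝 (e y)] t := by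
      filter_upwards [e.open_target.mem_nhds (e.map_source hye)] with z hz
      rw [Function.comp_apply, hees, height, OpenPartialHomeomorph.coe_trans, Function.comp_apply,
        e.right_inv hz, hχt]
    rw [localForm_extChartAt _ hyx, hee, h2.fderiv_eq] at h1
    have h3 := localForm_extChartAt θ hyx
    rw [hee] at h3
    have hle := (hker (e y) (hχU hyχ)).2
    refine (ker_eq_of_ker_le ?_ fun v hv ↦ ?_).symm
    · exact fun h ↦ mfderiv_height_ne_zero hmem hy (ContinuousLinearMap.coe_injective h)
    · have hv' : θ y v = 0 := hv
      rw [← coordFrame_coordDeriv hyx v] at hv' ⊢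
      have h4 : localForm θ x₀ (e y) (coordDeriv V x₀ y v) = 0 := by rw [h3]; exact hv'
      have h5 : fderiv ℝ t (e y) (coordDeriv V x₀ y v) = 0 := hle h4
      rw [← h1] at h5
      exact h5

/-- The foliation defined by an integrable form without zeros: its charts are all the charts with
convex image whose plaques are tangent to the kernels of the form. -/
def foliationOfForm {θ : CovectorField n V} (hθ : ∀ x, SmoothFormAt θ x)
    (hint : ∀ x, ∀ u v w : TangentSpace (𝓡 (n + 1)) x, wedgeExtDerivative θ x u v w = 0)
    (hne : ∀ x, θ x ≠ 0) : Foliation n V where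
  charts := {φ | φ ∈ IsManifold.maximalAtlas (𝓡 (n + 1)) ∞ V ∧ Convex ℝ φ.target ∧
    ∀ y ∈ φ.source, LinearMap.ker (mfderiv (𝓡 (n + 1)) 𝓘(ℝ, ℝ) (height φ) y).toLinearMap =
      LinearMap.ker (θ y).toLinearMap}
  smooth := fun φ hφ ↦ hφ.1
  convex := fun φ hφ ↦ hφ.2.1
  cover := fun x ↦ by
    obtain ⟨φ, hφ, hc, hx, hk⟩ := exists_chart_ker_eq hθ hint hne x
    exact ⟨φ, ⟨hφ, hc, hk⟩, hx⟩
  compatible := fun φ hφ ψ hψ ↦ plaqueCompatible_of_ker_mfderiv_eq hφ.1 hψ.1 fun x hx ↦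
    (hφ.2.2 x hx.1).trans (hψ.2.2 x hx.2).symm
  maximal := fun φ hφ hc h ↦ by
    refine ⟨hφ, hc, fun y hy ↦ ?_⟩
    obtain ⟨ψ, hψ, hψc, hyψ, hk⟩ := exists_chart_ker_eq hθ hint hne y
    exact ((h ψ ⟨hψ, hψc, hk⟩).ker_mfderiv_eq hφ hψ hy hyψ).trans (hk y hyψ)

theorem tangent_foliationOfForm {θ : CovectorField n V} (hθ : ∀ x, SmoothFormAt θ x)
    (hint : ∀ x, ∀ u v w : TangentSpace (𝓡 (n + 1)) x, wedgeExtDerivative θ x u v w = 0)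
    (hne : ∀ x, θ x ≠ 0) (x : V) :
    (foliationOfForm hθ hint hne).tangent x = LinearMap.ker (θ x).toLinearMap := by
  obtain ⟨φ, hφ, hx⟩ := (foliationOfForm hθ hint hne).cover x
  rw [Foliation.tangent_eq_ker _ hφ hx]
  exact hφ.2.2 x hx

/-- A foliation is determined by its tangent spaces. -/
theorem Foliation.eq_of_tangent_eq {F G : Foliation n V} (h : ∀ x, F.tangent x = G.tangent x) :
    F = G := by
  have key : ∀ F G : Foliation n V, (∀ x, F.tangent x = G.tangent x) → F.charts ⊆ G.charts := by
    intro F G h φ hφ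
    refine G.maximal φ (F.smooth φ hφ) (F.convex φ hφ) fun ψ hψ ↦ ?_
    refine plaqueCompatible_of_ker_mfderiv_eq (F.smooth φ hφ) (G.smooth ψ hψ) fun x hx ↦ ?_
    rw [← F.tangent_eq_ker hφ hx.1, ← G.tangent_eq_ker hψ hx.2, h x]
  exact Foliation.ext_charts (Subset.antisymm (key F G h) (key G F fun x ↦ (h x).symm))

end IntegralCharts

/-! ### The projectors at a point -/

section MetricAlgebra

variable {n : ℕ} {V : Type*} [TopologicalSpace V]
  [ChartedSpace (EuclideanSpace ℝ (Fin (n + 1))) V]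

theorem exists_smul_eq_of_ker_eq {x : V} {α β : TangentSpace (𝓡 (n + 1)) x →L[ℝ] ℝ} (hβ : β ≠ 0)
    (h : LinearMap.ker α.toLinearMap = LinearMap.ker β.toLinearMap) :
    ∃ c : ℝ, c ≠ 0 ∧ α = c • β := by
  have hk : ∀ v, α v = 0 ↔ β v = 0 := fun v ↦ SetLike.ext_iff.1 h v
  obtain ⟨v, hv⟩ := DFunLike.ne_iff.1 hβ
  have hv : β v ≠ 0 := hv
  refine ⟨α v / β v, div_ne_zero (fun h ↦ hv ((hk v).1 h)) hv,
    ContinuousLinearMap.ext fun w ↦ ?_⟩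
  have h1 : α (w - (β w / β v) • v) = 0 := (hk _).2 (by
    rw [map_sub, map_smul, smul_eq_mul, div_mul_cancel₀ _ hv, sub_self])
  rw [map_sub, map_smul, smul_eq_mul, sub_eq_zero] at h1
  rw [h1, smul_apply, smul_eq_mul]
  ring

variable [IsManifold (𝓡 (n + 1)) ∞ V]

namespace PseudoRiemannianMetric

variable (g : PseudoRiemannianMetric n V) {x : V} {α : TangentSpace (𝓡 (n + 1)) x →L[ℝ] ℝ}

theorem eq_sharp {v : TangentSpace (𝓡 (n + 1)) x} (h : ∀ w, g.form x v w = α w) :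
    v = g.sharp x α := by
  refine sub_eq_zero.1 (g.nondegenerate x _ fun w ↦ ?_)
  rw [map_sub, sub_apply, h, g.form_sharp, sub_self]

theorem inverse_eq (α β : TangentSpace (𝓡 (n + 1)) x →L[ℝ] ℝ) :
    g.inverse x α β = α (g.sharp x β) :=
  g.form_sharp x α _

theorem sharp_smul (c : ℝ) (α : TangentSpace (𝓡 (n + 1)) x →L[ℝ] ℝ) :
    g.sharp x (c • α) = c • g.sharp x α := by
  refine (g.eq_sharp fun w ↦ ?_).symm
  rw [map_smul, smul_apply, smul_apply, g.form_sharp]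

theorem inverse_smul (c : ℝ) (α : TangentSpace (𝓡 (n + 1)) x →L[ℝ] ℝ) :
    g.inverse x (c • α) (c • α) = c ^ 2 * g.inverse x α α := by
  rw [inverse_eq, inverse_eq, sharp_smul, smul_apply, map_smul, smul_eq_mul, smul_eq_mul]
  ring

/-- The kernel of a non-zero covector is a non-degenerate hyperplane exactly when the covector is
not a null covector. -/
theorem inverse_ne_zero_iff (hα : α ≠ 0) :
    g.inverse x α α ≠ 0 ↔ ∀ v, α v = 0 → (∀ w, α w = 0 → g.form x v w = 0) → v = 0 := by
  rw [inverse_eq]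
  constructor
  · intro h v hv hvw
    refine g.nondegenerate x v fun w ↦ ?_
    have h1 := hvw (w - (α w / α (g.sharp x α)) • g.sharp x α) (by
      rw [map_sub, map_smul, smul_eq_mul, div_mul_cancel₀ _ h, sub_self])
    rw [map_sub, map_smul, g.symm x v (g.sharp x α), g.form_sharp, hv, smul_zero, sub_zero] at h1
    exact h1
  · intro h h0
    have h1 := h _ h0 fun w hw ↦ by rw [g.form_sharp, hw]
    refine hα (ContinuousLinearMap.ext fun w ↦ ?_)
    rw [← g.form_sharp, h1, map_zero]

theorem ne_zero_of_inverse_ne_zero (h : g.inverse x α α ≠ 0) : α ≠ 0 := by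
  rintro rfl
  exact h (by rw [inverse_eq]; rfl)

theorem formProjector_apply (θ : CovectorField n V) (v : TangentSpace (𝓡 (n + 1)) x) :
    g.formProjector θ x v =
      ((g.inverse x (θ x) (θ x))⁻¹ * θ x v) • g.sharp x (θ x) := by
  rw [formProjector, smul_apply, ContinuousLinearMap.smulRight_apply, smul_smul]

theorem formProjector_eq_of_smul {θ θ' : CovectorField n V} {c : ℝ} (hc : c ≠ 0)
    (h : θ' x = c • θ x) : g.formProjector θ' x = g.formProjector θ x := by
  ext1 v
  rw [formProjector_apply, formProjector_apply, h, inverse_smul, sharp_smul, smul_smul, smul_apply,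
    smul_eq_mul]
  congr 1
  field_simp

/-- The projector of a 1-form depends only on the kernels of the form. -/
theorem formProjector_eq_of_ker_eq {θ θ' : CovectorField n V}
    (h : LinearMap.ker (θ' x).toLinearMap = LinearMap.ker (θ x).toLinearMap) :
    g.formProjector θ' x = g.formProjector θ x := by
  by_cases h0 : θ x = 0
  · have h1 : θ' x = 0 := ContinuousLinearMap.ext fun v ↦
      (SetLike.ext_iff.1 h v).2 (by rw [h0]; rfl)
    exact g.formProjector_eq_of_smul one_ne_zero (by rw [h0, h1, smul_zero])
  · obtain ⟨c, hc, h1⟩ := exists_smul_eq_of_ker_eq h0 h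
    exact g.formProjector_eq_of_smul hc h1

theorem apply_formProjector {θ : CovectorField n V} (h : g.inverse x (θ x) (θ x) ≠ 0)
    (v : TangentSpace (𝓡 (n + 1)) x) : θ x (g.formProjector θ x v) = θ x v := by
  rw [formProjector_apply, map_smul, ← inverse_eq, smul_eq_mul]
  field_simp

theorem formProjector_formProjector {θ : CovectorField n V} (h : g.inverse x (θ x) (θ x) ≠ 0)
    (v : TangentSpace (𝓡 (n + 1)) x) :
    g.formProjector θ x (g.formProjector θ x v) = g.formProjector θ x v := by
  rw [g.formProjector_apply, apply_formProjector g h, ← g.formProjector_apply]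

theorem formProjector_eq_zero_iff {θ : CovectorField n V} (h : g.inverse x (θ x) (θ x) ≠ 0)
    (v : TangentSpace (𝓡 (n + 1)) x) : g.formProjector θ x v = 0 ↔ θ x v = 0 := by
  refine ⟨fun h0 ↦ ?_, fun h0 ↦ ?_⟩
  · rw [← g.apply_formProjector h, h0, map_zero]
  · rw [formProjector_apply, h0, mul_zero, zero_smul]

theorem mem_range_formProjector_iff {θ : CovectorField n V} (h : g.inverse x (θ x) (θ x) ≠ 0)
    (v : TangentSpace (𝓡 (n + 1)) x) :
    v ∈ range (g.formProjector θ x) ↔ ∀ w, θ x w = 0 → g.form x v w = 0 := by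
  constructor
  · rintro ⟨u, rfl⟩ w hw
    rw [formProjector_apply, map_smul, smul_apply, g.form_sharp, hw, smul_zero]
  · intro hv
    refine ⟨v, (sub_eq_zero.1 ?_).symm⟩
    have h0 : θ x (v - g.formProjector θ x v) = 0 := by
      rw [map_sub, g.apply_formProjector h, sub_self]
    refine (g.inverse_ne_zero_iff (g.ne_zero_of_inverse_ne_zero h)).1 h _ h0 fun w hw ↦ ?_
    rw [map_sub, sub_apply, hv w hw, formProjector_apply, map_smul, smul_apply, g.form_sharp, hw,
      smul_zero, sub_zero]

end PseudoRiemannianMetric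

/-- A pair of complementary projectors is determined by the ranges of both. -/
theorem IsProjectorPair.unique {g : PseudoRiemannianMetric n V}
    {D : ∀ x : V, Submodule ℝ (TangentSpace (𝓡 (n + 1)) x)} {P Q P' Q' : EndoField n V}
    (h : IsProjectorPair g D P Q) (h' : IsProjectorPair g D P' Q') : P' = P ∧ Q' = Q := by
  have hP : ∀ x v, P x (P' x v) = P' x v := by
    intro x v
    obtain ⟨u, hu⟩ := (h.range_left x (P' x v)).2 ((h'.range_left x _).1 ⟨v, rfl⟩)
    rw [← hu]
    exact DFunLike.congr_fun (h.left_idem x) u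
  have hQ : ∀ x v, P x (Q' x v) = 0 := by
    intro x v
    obtain ⟨u, hu⟩ := (h.range_right x (Q' x v)).2 ((h'.range_right x _).1 ⟨v, rfl⟩)
    rw [← hu]
    exact DFunLike.congr_fun (h.left_right x) u
  have hPP : ∀ x, P' x = P x := by
    intro x
    ext1 v
    have h1 : P' x v + Q' x v = v := DFunLike.congr_fun (h'.add_eq_id x) v
    have h2 : P x (P' x v + Q' x v) = P x v := by rw [h1]
    rw [map_add, hP, hQ, add_zero] at h2
    exact h2
  refine ⟨funext hPP, funext fun x ↦ ?_⟩
  have h1 := h'.add_eq_id x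
  rw [← h.add_eq_id x, hPP x] at h1
  exact add_left_cancel h1

end MetricAlgebra

/-! ### Smoothness of the raised form and of the projectors -/

section Coordinates

variable {n : ℕ} {V : Type*} [TopologicalSpace V]
  [ChartedSpace (EuclideanSpace ℝ (Fin (n + 1))) V]

theorem contMDiffAt_smulRight {E : Type*} [NormedAddCommGroup E] [NormedSpace ℝ E]
    {a : V → E →L[ℝ] ℝ} {s : V → E} {x : V} (ha : ContMDiffAt (𝓡 (n + 1)) 𝓘(ℝ, E →L[ℝ] ℝ) ∞ a x)
    (hs : ContMDiffAt (𝓡 (n + 1)) 𝓘(ℝ, E) ∞ s x) :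
    ContMDiffAt (𝓡 (n + 1)) 𝓘(ℝ, E →L[ℝ] E) ∞ (fun y ↦ (a y).smulRight (s y)) x := by
  have h1 : ContMDiffAt (𝓡 (n + 1)) 𝓘(ℝ, E →L[ℝ] E →L[ℝ] E) ∞
      (fun y ↦ ContinuousLinearMap.smulRightL ℝ E E (a y)) x :=
    ((ContinuousLinearMap.smulRightL ℝ E E).contDiff.contMDiff.contMDiffAt).comp x ha
  exact h1.clm_apply hs

variable [IsManifold (𝓡 (n + 1)) ∞ V]

/-- Components of a covector field in the preferred chart at `x₀`. -/
def formCoords (θ : CovectorField n V) (x₀ y : V) : EuclideanSpace ℝ (Fin (n + 1)) →L[ℝ] ℝ :=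
  (θ y).comp (coordFrame V x₀ y)

/-- Components of an endomorphism field in the preferred chart at `x₀`. -/
def endoCoords (A : EndoField n V) (x₀ y : V) :
    EuclideanSpace ℝ (Fin (n + 1)) →L[ℝ] EuclideanSpace ℝ (Fin (n + 1)) :=
  (coordDeriv V x₀ y).comp ((A y).comp (coordFrame V x₀ y))

/-- The Gram matrix of a metric in the preferred chart at `x₀`, as an operator from the model space
to its dual. -/
def metricCoords (g : PseudoRiemannianMetric n V) (x₀ y : V) :
    EuclideanSpace ℝ (Fin (n + 1)) →L[ℝ] EuclideanSpace ℝ (Fin (n + 1)) →L[ℝ] ℝ :=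
  (ContinuousLinearMap.precomp ℝ (coordFrame V x₀ y)).comp ((g.form y).comp (coordFrame V x₀ y))

theorem SmoothFormAt.contMDiffAt_formCoords {θ : CovectorField n V} {x : V}
    (h : SmoothFormAt θ x) :
    ContMDiffAt (𝓡 (n + 1)) 𝓘(ℝ, EuclideanSpace ℝ (Fin (n + 1)) →L[ℝ] ℝ) ∞
      (formCoords θ x) x := by
  have h1 := (contMDiffAt_iff_contDiffAt.2 (h.contDiffAt (mem_extChartAt_source x))).comp x
    (contMDiffAt_extChartAt (I := 𝓡 (n + 1)) (n := ∞) (x := x))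
  refine h1.congr_of_eventuallyEq ?_
  filter_upwards [extChartAt_source_mem_nhds (I := 𝓡 (n + 1)) x] with y hy
  exact (localForm_extChartAt θ hy).symm

/-- Smoothness of a field of endomorphisms, as a section of the bundle of `(1, 1)`-tensors, is
smoothness of its matrix in the preferred chart at `x`. -/
theorem contMDiffAt_endo_iff (A : EndoField n V) (x : V) :
    ContMDiffAt (𝓡 (n + 1)) ((𝓡 (n + 1)).prod 𝓘(ℝ, EuclideanSpace ℝ (Fin (n + 1)) →L[ℝ]
      EuclideanSpace ℝ (Fin (n + 1)))) ∞
    (fun x : V ↦ TotalSpace.mk' (EuclideanSpace ℝ (Fin (n + 1)) →L[ℝ]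
        EuclideanSpace ℝ (Fin (n + 1)))
      (E := fun x : V ↦ TangentSpace (𝓡 (n + 1)) x →L[ℝ] TangentSpace (𝓡 (n + 1)) x) x (A x)) x ↔
    ContMDiffAt (𝓡 (n + 1)) 𝓘(ℝ, EuclideanSpace ℝ (Fin (n + 1)) →L[ℝ]
      EuclideanSpace ℝ (Fin (n + 1))) ∞ (endoCoords A x) x := by
  have hmem : x ∈ (trivializationAt (EuclideanSpace ℝ (Fin (n + 1)) →L[ℝ]
      EuclideanSpace ℝ (Fin (n + 1)))
        (fun x : V ↦ TangentSpace (𝓡 (n + 1)) x →L[ℝ] TangentSpace (𝓡 (n + 1)) x) x).baseSet :=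
    mem_baseSet_trivializationAt _ _ x
  rw [Trivialization.contMDiffAt_section_iff _ hmem]
  refine Filter.EventuallyEq.contMDiffAt_iff ?_
  filter_upwards [extChartAt_source_mem_nhds (I := 𝓡 (n + 1)) x] with y hy
  rw [hom_trivializationAt_apply, endoCoords, coordDeriv_eq hy]
  rfl

set_option synthInstance.maxHeartbeats 400000 in
theorem contMDiffAt_metricCoords (g : PseudoRiemannianMetric n V) (x : V) :
    ContMDiffAt (𝓡 (n + 1)) 𝓘(ℝ, EuclideanSpace ℝ (Fin (n + 1)) →L[ℝ]
      EuclideanSpace ℝ (Fin (n + 1)) →L[ℝ] ℝ) ∞ (metricCoords g x) x := by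
  refine ((contMDiffAt_hom_bundle _).1 (g.smooth x)).2.congr_of_eventuallyEq ?_
  filter_upwards [extChartAt_source_mem_nhds (I := 𝓡 (n + 1)) x] with y hy
  have hy' : y ∈ (trivializationAt (EuclideanSpace ℝ (Fin (n + 1)) →L[ℝ] ℝ)
        (fun x : V ↦ TangentSpace (𝓡 (n + 1)) x →L[ℝ] ℝ) x).baseSet := by
    simpa using hy
  ext u v
  rw [ContinuousLinearMap.inCoordinates, ContinuousLinearMap.comp_apply,
    ContinuousLinearMap.comp_apply, Trivialization.continuousLinearMapAt_apply,
    Trivialization.linearMapAt_apply, if_pos hy', hom_trivializationAt_apply]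
  change _ = (Bundle.Trivial.trivialization V ℝ).continuousLinearMapAt ℝ y
      (g.form y (coordFrame V x y u) (coordFrame V x y v))
  rw [Bundle.Trivial.continuousLinearMapAt_trivialization]
  rfl

/-- In coordinates, raising an index is the application of the inverse matrix of the metric. -/
theorem coordDeriv_sharp (g : PseudoRiemannianMetric n V) (θ : CovectorField n V) {x y : V}
    (hy : y ∈ (extChartAt (𝓡 (n + 1)) x).source) :
    ∃ e : EuclideanSpace ℝ (Fin (n + 1)) ≃L[ℝ] (EuclideanSpace ℝ (Fin (n + 1)) →L[ℝ] ℝ),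
      (e : EuclideanSpace ℝ (Fin (n + 1)) →L[ℝ] (EuclideanSpace ℝ (Fin (n + 1)) →L[ℝ] ℝ)) =
        metricCoords g x y ∧
      coordDeriv V x y (g.sharp y (θ y)) = e.symm (formCoords θ x y) := by
  have hinj : LinearMap.ker (metricCoords g x y).toLinearMap = ⊥ := by
    refine LinearMap.ker_eq_bot'.2 fun u hu ↦ ?_
    rw [← coordDeriv_coordFrame hy u, g.nondegenerate y (coordFrame V x y u), map_zero]
    intro w
    rw [← coordFrame_coordDeriv hy w]
    exact DFunLike.congr_fun hu (coordDeriv V x y w)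
  have hsharp : ∀ α : EuclideanSpace ℝ (Fin (n + 1)) →L[ℝ] ℝ, metricCoords g x y
      (coordDeriv V x y (g.sharp y (α.comp (coordDeriv V x y)))) = α := by
    intro α
    ext v
    change g.form y (coordFrame V x y (coordDeriv V x y _)) (coordFrame V x y v) = _
    rw [coordFrame_coordDeriv hy, g.form_sharp, ContinuousLinearMap.comp_apply,
      coordDeriv_coordFrame hy]
  refine ⟨ContinuousLinearEquiv.ofBijective (metricCoords g x y) hinj
    (LinearMap.range_eq_top.2 fun α ↦ ⟨_, hsharp α⟩), ?_, ?_⟩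
  · rfl
  · rw [ContinuousLinearEquiv.eq_symm_apply]
    refine Eq.trans ?_ (hsharp (formCoords θ x y))
    refine congrArg (fun α ↦ metricCoords g x y (coordDeriv V x y (g.sharp y α))) ?_
    ext v
    change _ = θ y (coordFrame V x y (coordDeriv V x y v))
    rw [coordFrame_coordDeriv hy]

theorem contMDiffAt_coordDeriv_sharp (g : PseudoRiemannianMetric n V) {θ : CovectorField n V}
    {x : V} (h : SmoothFormAt θ x) :
    ContMDiffAt (𝓡 (n + 1)) 𝓘(ℝ, EuclideanSpace ℝ (Fin (n + 1))) ∞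
      (fun y ↦ coordDeriv V x y (g.sharp y (θ y))) x := by
  obtain ⟨e, he, -⟩ := coordDeriv_sharp g θ (mem_extChartAt_source (I := 𝓡 (n + 1)) x)
  have h1 : ContMDiffAt (𝓡 (n + 1)) 𝓘(ℝ, (EuclideanSpace ℝ (Fin (n + 1)) →L[ℝ] ℝ) →L[ℝ]
      EuclideanSpace ℝ (Fin (n + 1))) ∞
      (fun y ↦ ContinuousLinearMap.inverse (metricCoords g x y)) x := by
    have h2 := contDiffAt_map_inverse (n := ∞) e
    rw [he] at h2
    exact (contMDiffAt_iff_contDiffAt.2 h2).comp x (contMDiffAt_metricCoords g x)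
  refine (h1.clm_apply h.contMDiffAt_formCoords).congr_of_eventuallyEq ?_
  filter_upwards [extChartAt_source_mem_nhds (I := 𝓡 (n + 1)) x] with y hy
  obtain ⟨e, he, hes⟩ := coordDeriv_sharp g θ hy
  rw [hes, ← he, ContinuousLinearMap.inverse_equiv]
  rfl

theorem contMDiffAt_inverse (g : PseudoRiemannianMetric n V) {θ : CovectorField n V}
    {x : V} (h : SmoothFormAt θ x) :
    ContMDiffAt (𝓡 (n + 1)) 𝓘(ℝ, ℝ) ∞ (fun y ↦ g.inverse y (θ y) (θ y)) x := by
  refine (h.contMDiffAt_formCoords.clm_apply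
    (contMDiffAt_coordDeriv_sharp g h)).congr_of_eventuallyEq ?_
  filter_upwards [extChartAt_source_mem_nhds (I := 𝓡 (n + 1)) x] with y hy
  rw [g.inverse_eq, formCoords, ContinuousLinearMap.comp_apply, coordFrame_coordDeriv hy]

theorem contMDiffAt_formProjector (g : PseudoRiemannianMetric n V) {θ : CovectorField n V}
    {x : V} (h : SmoothFormAt θ x) (hx : g.inverse x (θ x) (θ x) ≠ 0) :
    ContMDiffAt (𝓡 (n + 1)) 𝓘(ℝ, EuclideanSpace ℝ (Fin (n + 1)) →L[ℝ]
      EuclideanSpace ℝ (Fin (n + 1))) ∞ (endoCoords (g.formProjector θ) x) x := by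
  have h1 := ((contMDiffAt_inverse g h).inv₀ hx).smul
    (contMDiffAt_smulRight h.contMDiffAt_formCoords (contMDiffAt_coordDeriv_sharp g h))
  refine h1.congr_of_eventuallyEq (Filter.Eventually.of_forall fun y ↦ ?_)
  ext1 u
  change coordDeriv V x y (g.formProjector θ y (coordFrame V x y u)) = _
  rw [g.formProjector_apply, map_smul, mul_smul]
  rfl

theorem contMDiffAt_id_sub {A : EndoField n V} {x : V}
    (h : ContMDiffAt (𝓡 (n + 1)) 𝓘(ℝ, EuclideanSpace ℝ (Fin (n + 1)) →L[ℝ]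
      EuclideanSpace ℝ (Fin (n + 1))) ∞ (endoCoords A x) x) :
    ContMDiffAt (𝓡 (n + 1)) 𝓘(ℝ, EuclideanSpace ℝ (Fin (n + 1)) →L[ℝ]
      EuclideanSpace ℝ (Fin (n + 1))) ∞
      (endoCoords (fun y ↦ ContinuousLinearMap.id ℝ (TangentSpace (𝓡 (n + 1)) y) - A y) x) x := by
  refine ((contMDiffAt_const (c := ContinuousLinearMap.id ℝ
    (EuclideanSpace ℝ (Fin (n + 1))))).sub h).congr_of_eventuallyEq ?_
  filter_upwards [extChartAt_source_mem_nhds (I := 𝓡 (n + 1)) x] with y hy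
  ext1 u
  change coordDeriv V x y (coordFrame V x y u - A y (coordFrame V x y u)) =
    u - coordDeriv V x y (A y (coordFrame V x y u))
  rw [map_sub, coordDeriv_coordFrame hy]

theorem continuousAt_section_iff (X : ∀ x : V, TangentSpace (𝓡 (n + 1)) x) (x : V) :
    ContinuousAt (fun x : V ↦ (⟨x, X x⟩ : TangentBundle (𝓡 (n + 1)) V)) x ↔
      ContinuousAt (fun y ↦ coordDeriv V x y (X y)) x := by
  rw [FiberBundle.continuousAt_totalSpace]
  refine (and_iff_right continuousAt_id).trans (continuousAt_congr ?_)
  filter_upwards [extChartAt_source_mem_nhds (I := 𝓡 (n + 1)) x] with y hy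
  rw [coordDeriv_eq hy, Trivialization.continuousLinearMapAt_apply,
    Trivialization.linearMapAt_apply, if_pos (by simpa using hy)]

theorem continuousAt_apply {θ : CovectorField n V} {X : ∀ x : V, TangentSpace (𝓡 (n + 1)) x}
    {x : V} (hθ : SmoothFormAt θ x)
    (hX : ContinuousAt (fun x : V ↦ (⟨x, X x⟩ : TangentBundle (𝓡 (n + 1)) V)) x) :
    ContinuousAt (fun y ↦ θ y (X y)) x := by
  refine (hθ.contMDiffAt_formCoords.continuousAt.clm_apply
    ((continuousAt_section_iff X x).1 hX)).congr ?_
  filter_upwards [extChartAt_source_mem_nhds (I := 𝓡 (n + 1)) x] with y hy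
  rw [formCoords, ContinuousLinearMap.comp_apply, coordFrame_coordDeriv hy]

end Coordinates

/-! ### The projectors of a foliation -/

section Projectors

variable {n : ℕ} {V : Type*} [TopologicalSpace V]
  [ChartedSpace (EuclideanSpace ℝ (Fin (n + 1))) V] [IsManifold (𝓡 (n + 1)) ∞ V]
  {g : PseudoRiemannianMetric n V}

/-- The projectors of a field of non-degenerate hyperplanes which is locally the field of kernels of
smooth forms. -/
theorem isProjectorPair_formProjector {θ : CovectorField n V}
    {D : ∀ x : V, Submodule ℝ (TangentSpace (𝓡 (n + 1)) x)}
    (hD : ∀ x, D x = LinearMap.ker (θ x).toLinearMap) (hθ : ∀ x, g.inverse x (θ x) (θ x) ≠ 0)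
    (hloc : ∀ x, ∃ β : CovectorField n V, SmoothFormAt β x ∧ β x ≠ 0 ∧
      ∀ᶠ y in 𝓝 x, LinearMap.ker (θ y).toLinearMap = LinearMap.ker (β y).toLinearMap) :
    IsProjectorPair g D (g.formProjector θ)
      (fun x ↦ ContinuousLinearMap.id ℝ (TangentSpace (𝓡 (n + 1)) x) - g.formProjector θ x) := by
  have hDv : ∀ x v, v ∈ D x ↔ θ x v = 0 := fun x v ↦ by rw [hD x]; exact Iff.rfl
  have hsm : ∀ x, ContMDiffAt (𝓡 (n + 1)) 𝓘(ℝ, EuclideanSpace ℝ (Fin (n + 1)) →L[ℝ]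
      EuclideanSpace ℝ (Fin (n + 1))) ∞ (endoCoords (g.formProjector θ) x) x := by
    intro x
    obtain ⟨β, hβ, hβ0, hker⟩ := hloc x
    have hβx : g.inverse x (β x) (β x) ≠ 0 := by
      have hk : ∀ v, β x v = 0 ↔ θ x v = 0 := fun v ↦ SetLike.ext_iff.1 hker.self_of_nhds.symm v
      have h1 := (g.inverse_ne_zero_iff (g.ne_zero_of_inverse_ne_zero (hθ x))).1 (hθ x)
      exact (g.inverse_ne_zero_iff hβ0).2 fun v hv hvw ↦
        h1 v ((hk v).1 hv) fun w hw ↦ hvw w ((hk w).2 hw)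
    refine (contMDiffAt_formProjector g hβ hβx).congr_of_eventuallyEq ?_
    filter_upwards [hker] with y hy
    rw [endoCoords, endoCoords, g.formProjector_eq_of_ker_eq hy]
  exact
    { smooth_left := fun x ↦ (contMDiffAt_endo_iff _ x).2 (hsm x)
      smooth_right := fun x ↦ (contMDiffAt_endo_iff _ x).2 (contMDiffAt_id_sub (hsm x))
      add_eq_id := fun x ↦ add_sub_cancel _ _
      left_idem := fun x ↦ ContinuousLinearMap.ext fun v ↦ g.formProjector_formProjector (hθ x) v
      right_idem := fun x ↦ ContinuousLinearMap.ext fun v ↦ by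
        change v - g.formProjector θ x v - g.formProjector θ x (v - g.formProjector θ x v) =
          v - g.formProjector θ x v
        rw [map_sub, g.formProjector_formProjector (hθ x), sub_self, sub_zero]
      left_right := fun x ↦ ContinuousLinearMap.ext fun v ↦ by
        change g.formProjector θ x (v - g.formProjector θ x v) = 0
        rw [map_sub, g.formProjector_formProjector (hθ x), sub_self]
      right_left := fun x ↦ ContinuousLinearMap.ext fun v ↦ by
        change g.formProjector θ x v - g.formProjector θ x (g.formProjector θ x v) = 0
        rw [g.formProjector_formProjector (hθ x), sub_self]
      range_right := fun x v ↦ by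
        rw [hDv, ← g.formProjector_eq_zero_iff (hθ x)]
        constructor
        · rintro ⟨u, rfl⟩
          change g.formProjector θ x (u - g.formProjector θ x u) = 0
          rw [map_sub, g.formProjector_formProjector (hθ x), sub_self]
        · intro hv
          refine ⟨v, ?_⟩
          change v - g.formProjector θ x v = v
          rw [hv, sub_zero]
      range_left := fun x v ↦ by
        rw [g.mem_range_formProjector_iff (hθ x)]
        exact forall_congr' fun w ↦ by rw [hDv] }

theorem isIntegrableNonNullOn_differential {t : V → ℝ} {U : Set V} (hU : IsOpen U)
    (ht : ContMDiffOn (𝓡 (n + 1)) 𝓘(ℝ, ℝ) ∞ t U)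
    (h : ∀ x ∈ U, g.inverse x (differential t x) (differential t x) ≠ 0) :
    IsIntegrableNonNullOn g (differential t) U := by
  have ht' : ∀ x ∈ U, ∀ᶠ y in 𝓝 x, ContMDiffAt (𝓡 (n + 1)) 𝓘(ℝ, ℝ) ∞ t y := fun x hx ↦ by
    filter_upwards [hU.mem_nhds hx] with y hy using ht.contMDiffAt (hU.mem_nhds hy)
  refine ⟨smoothFormOn_of_forall fun x hx ↦ smoothFormAt_mfderiv (ht' x hx), fun x hx ↦ ?_, h⟩
  exact wedgeExtDerivative_eq_zero (f := fun _ ↦ 1) (smoothFormAt_mfderiv (ht' x hx))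
    contMDiffAt_const (ht' x hx) (Filter.Eventually.of_forall fun y ↦ (one_smul ℝ _).symm)

namespace Foliation

variable (F : Foliation n V)

/-- The differential at `x` of the transverse coordinate of some foliated chart around `x`, chosen
independently at each point. -/
def conormal : CovectorField n V := fun x ↦ differential (height (F.cover x).choose) x

theorem tangent_eq_ker_differential {φ : OpenPartialHomeomorph V (EuclideanSpace ℝ (Fin (n + 1)))}
    (hφ : φ ∈ F.charts) {x : V} (hx : x ∈ φ.source) :
    F.tangent x = LinearMap.ker (differential (height φ) x).toLinearMap :=
  F.tangent_eq_ker hφ hx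

theorem tangent_eq_ker_conormal (x : V) :
    F.tangent x = LinearMap.ker (F.conormal x).toLinearMap :=
  F.tangent_eq_ker (F.cover x).choose_spec.1 (F.cover x).choose_spec.2

theorem differential_height_ne_zero
    {φ : OpenPartialHomeomorph V (EuclideanSpace ℝ (Fin (n + 1)))} (hφ : φ ∈ F.charts) {x : V}
    (hx : x ∈ φ.source) : differential (n := n) (height φ) x ≠ 0 :=
  mfderiv_height_ne_zero (F.smooth φ hφ) hx

theorem conormal_ne_zero (x : V) : F.conormal x ≠ 0 :=
  F.differential_height_ne_zero (F.cover x).choose_spec.1 (F.cover x).choose_spec.2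

theorem eventually_contMDiffAt_height
    {φ : OpenPartialHomeomorph V (EuclideanSpace ℝ (Fin (n + 1)))} (hφ : φ ∈ F.charts) {x : V}
    (hx : x ∈ φ.source) : ∀ᶠ y in 𝓝 x, ContMDiffAt (𝓡 (n + 1)) 𝓘(ℝ, ℝ) ∞ (height φ) y := by
  filter_upwards [φ.open_source.mem_nhds hx] with y hy using
    (contMDiffOn_height (F.smooth φ hφ)).contMDiffAt (φ.open_source.mem_nhds hy)

variable {F}

theorem isNondegenerate_iff {θ : CovectorField n V}
    (hker : ∀ x, F.tangent x = LinearMap.ker (θ x).toLinearMap) (hθ : ∀ x, θ x ≠ 0) :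
    F.IsNondegenerate g ↔ ∀ x, g.inverse x (θ x) (θ x) ≠ 0 := by
  refine forall_congr' fun x ↦ ?_
  rw [g.inverse_ne_zero_iff (hθ x), hker x]
  exact Iff.rfl

theorem IsNondegenerate.inverse_ne_zero (hF : F.IsNondegenerate g) {x : V}
    {α : TangentSpace (𝓡 (n + 1)) x →L[ℝ] ℝ}
    (hker : F.tangent x = LinearMap.ker α.toLinearMap) (hα : α ≠ 0) : g.inverse x α α ≠ 0 := by
  refine (g.inverse_ne_zero_iff hα).2 ?_
  have h := hF x
  rw [hker] at h
  exact h

theorem IsNondegenerate.isProjectorPair (hF : F.IsNondegenerate g) :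
    IsProjectorPair g F.tangent (g.formProjector F.conormal)
      (fun x ↦ ContinuousLinearMap.id ℝ (TangentSpace (𝓡 (n + 1)) x) -
        g.formProjector F.conormal x) := by
  refine isProjectorPair_formProjector F.tangent_eq_ker_conormal
    (fun x ↦ hF.inverse_ne_zero (F.tangent_eq_ker_conormal x) (F.conormal_ne_zero x)) fun x ↦ ?_
  obtain ⟨φ, hφ, hx⟩ := F.cover x
  refine ⟨differential (height φ), smoothFormAt_mfderiv (F.eventually_contMDiffAt_height hφ hx),
    F.differential_height_ne_zero hφ hx, ?_⟩
  filter_upwards [φ.open_source.mem_nhds hx] with y hy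
  rw [← F.tangent_eq_ker_conormal, F.tangent_eq_ker_differential hφ hy]

theorem formProjector_conormal_eq {θ : CovectorField n V} {x : V}
    (hker : F.tangent x = LinearMap.ker (θ x).toLinearMap) :
    g.formProjector F.conormal x = g.formProjector θ x :=
  g.formProjector_eq_of_ker_eq ((F.tangent_eq_ker_conormal x).symm.trans hker)

theorem IsNondegenerate.isIntegrableNonNullOn_height (hF : F.IsNondegenerate g)
    {φ : OpenPartialHomeomorph V (EuclideanSpace ℝ (Fin (n + 1)))} (hφ : φ ∈ F.charts) :
    IsIntegrableNonNullOn g (differential (height φ)) φ.source :=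
  isIntegrableNonNullOn_differential φ.open_source (contMDiffOn_height (F.smooth φ hφ))
    fun _ hx ↦ hF.inverse_ne_zero (F.tangent_eq_ker_differential hφ hx)
      (F.differential_height_ne_zero hφ hx)

/-- A function without critical points which is constant on the leaves has the tangent spaces of the
leaves as kernels of its differential. -/
theorem tangent_eq_ker_of_const {t : V → ℝ} {x : V}
    (ht : MDifferentiableAt (𝓡 (n + 1)) 𝓘(ℝ, ℝ) t x)
    (hne : differential (n := n) t x ≠ 0) (hconst : ∀ y ∈ F.leaf x, t y = t x) :
    F.tangent x = LinearMap.ker (differential t x).toLinearMap := by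
  obtain ⟨φ, hφ, hx⟩ := F.cover x
  rw [F.tangent_eq_ker_differential hφ hx]
  refine ker_eq_of_ker_le (fun h ↦ hne (ContinuousLinearMap.coe_injective h))
    (ker_mfderiv_height_le (F.smooth φ hφ) hx ht ?_)
  filter_upwards [φ.open_source.mem_nhds hx] with y hy hyx
  exact hconst y (Relation.EqvGen.rel _ _ ⟨φ, hφ, hx, hy, hyx.symm⟩)

end Foliation

end Projectors

/-! ### Transversely orientable foliations -/

section Orientation

variable {n : ℕ} {V : Type*} [TopologicalSpace V]
  [ChartedSpace (EuclideanSpace ℝ (Fin (n + 1))) V] [IsManifold (𝓡 (n + 1)) ∞ V]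

/-- The multiple of `θ` with `g^♯(θ, θ) = ±1` and `θ(X) > 0`, where `θ(X)` and `g^♯(θ, θ)` do not
vanish; elsewhere it is `0`. -/
def normalizedForm (g : PseudoRiemannianMetric n V) (X : ∀ x : V, TangentSpace (𝓡 (n + 1)) x)
    (θ : CovectorField n V) : CovectorField n V :=
  fun x ↦ (θ x (X x) / |θ x (X x)| / √|g.inverse x (θ x) (θ x)|) • θ x

variable {g : PseudoRiemannianMetric n V} {X : ∀ x : V, TangentSpace (𝓡 (n + 1)) x}
  {θ β : CovectorField n V}

theorem normalizedForm_eq_of_ker_eq {x : V} (hβ : β x ≠ 0)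
    (hker : LinearMap.ker (θ x).toLinearMap = LinearMap.ker (β x).toLinearMap) :
    normalizedForm g X θ x = normalizedForm g X β x := by
  obtain ⟨c, hc, h⟩ := exists_smul_eq_of_ker_eq hβ hker
  rw [normalizedForm, normalizedForm, h, g.inverse_smul, smul_smul, smul_apply, smul_eq_mul,
    abs_mul, abs_mul, abs_pow, Real.sqrt_mul (by positivity), Real.sqrt_sq (abs_nonneg c)]
  congr 1
  have hc' : |c| ≠ 0 := abs_ne_zero.2 hc
  have h2 : c * c = |c| * |c| := (abs_mul_abs_self c).symm
  calc c * β x (X x) / (|c| * |β x (X x)|) / (|c| * √|g.inverse x (β x) (β x)|) * c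
      = c * c / (|c| * |c|) * (β x (X x) / |β x (X x)| / √|g.inverse x (β x) (β x)|) := by
        field_simp
    _ = _ := by rw [h2, div_self (mul_ne_zero hc' hc'), one_mul]

theorem div_abs_eventually_eq {M : Type*} [TopologicalSpace M] {a : M → ℝ} {x : M}
    (ha : ContinuousAt a x) (hx : a x ≠ 0) : ∀ᶠ y in 𝓝 x, a y / |a y| = a x / |a x| := by
  rcases hx.lt_or_gt with h | h
  · filter_upwards [ha.eventually_lt_const h] with y hy
    rw [abs_of_neg hy, abs_of_neg h, div_neg, div_neg, div_self hy.ne, div_self h.ne]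
  · filter_upwards [ha.eventually_const_lt h] with y hy
    rw [abs_of_pos hy, abs_of_pos h, div_self hy.ne', div_self h.ne']

/-- Around `x`, the normalized form is a smooth multiple of `β`: the sign of `β(X)` is locally
constant by continuity. -/
theorem exists_normalizedForm_eventually_eq {x : V} (hβ : SmoothFormAt β x)
    (hX : ContinuousAt (fun x : V ↦ (⟨x, X x⟩ : TangentBundle (𝓡 (n + 1)) V)) x)
    (hβX : β x (X x) ≠ 0) (hg : g.inverse x (β x) (β x) ≠ 0) :
    ∃ f : V → ℝ, ContMDiffAt (𝓡 (n + 1)) 𝓘(ℝ, ℝ) ∞ f x ∧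
      ∀ᶠ y in 𝓝 x, normalizedForm g X β y = f y • β y := by
  refine ⟨fun y ↦ β x (X x) / |β x (X x)| * (√|g.inverse y (β y) (β y)|)⁻¹, ?_, ?_⟩
  · have h1 : ContDiffAt ℝ ∞ (fun r : ℝ ↦ √|r|) (g.inverse x (β x) (β x)) :=
      (contDiffAt_abs hg).sqrt (abs_ne_zero.2 hg)
    have h2 : ContMDiffAt (𝓡 (n + 1)) 𝓘(ℝ, ℝ) ∞ (fun y ↦ √|g.inverse y (β y) (β y)|) x :=
      ContMDiffAt.comp (g := fun r : ℝ ↦ √|r|) x (contMDiffAt_iff_contDiffAt.2 h1)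
        (contMDiffAt_inverse g hβ)
    exact contMDiffAt_const.mul (h2.inv₀ (Real.sqrt_ne_zero'.2 (abs_pos.2 hg)))
  · filter_upwards [div_abs_eventually_eq (continuousAt_apply hβ hX) hβX] with y hy
    rw [normalizedForm, hy, div_eq_mul_inv _ (√_)]

theorem ker_normalizedForm {x : V} (hX : θ x (X x) ≠ 0) (hg : g.inverse x (θ x) (θ x) ≠ 0) :
    LinearMap.ker (normalizedForm g X θ x).toLinearMap = LinearMap.ker (θ x).toLinearMap := by
  ext v
  change _ * θ x v = 0 ↔ θ x v = 0
  refine ⟨fun h ↦ (mul_eq_zero.1 h).resolve_left ?_, fun h ↦ by rw [h, mul_zero]⟩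
  exact div_ne_zero (div_ne_zero hX (abs_ne_zero.2 hX)) (Real.sqrt_ne_zero'.2 (abs_pos.2 hg))

/-- A continuous transverse field `X` selects, among the multiples of the differentials of the
transverse coordinates, a global smooth form. -/
theorem Foliation.IsNondegenerate.exists_form_of_transverse {F : Foliation n V}
    (hF : F.IsNondegenerate g)
    (hX : Continuous (fun x : V ↦ (⟨x, X x⟩ : TangentBundle (𝓡 (n + 1)) V)))
    (hXF : ∀ x, X x ∉ F.tangent x) :
    ∃ θ : CovectorField n V, IsIntegrableNonNullOn g θ univ ∧
      ∀ x, F.tangent x = LinearMap.ker (θ x).toLinearMap := by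
  have hcX : ∀ x, F.conormal x (X x) ≠ 0 := fun x h ↦ hXF x (by
    rw [F.tangent_eq_ker_conormal]; exact h)
  have hcg : ∀ x, g.inverse x (F.conormal x) (F.conormal x) ≠ 0 := fun x ↦
    hF.inverse_ne_zero (F.tangent_eq_ker_conormal x) (F.conormal_ne_zero x)
  have hker : ∀ x, F.tangent x = LinearMap.ker (normalizedForm g X F.conormal x).toLinearMap :=
    fun x ↦ by rw [ker_normalizedForm (hcX x) (hcg x), F.tangent_eq_ker_conormal]
  have hloc : ∀ x, SmoothFormAt (normalizedForm g X F.conormal) x ∧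
      ∀ u v w : TangentSpace (𝓡 (n + 1)) x,
        wedgeExtDerivative (normalizedForm g X F.conormal) x u v w = 0 := by
    intro x
    obtain ⟨φ, hφ, hx⟩ := F.cover x
    have hsm := F.eventually_contMDiffAt_height hφ hx
    have hβX : differential (height φ) x (X x) ≠ 0 := fun h ↦ hXF x (by
      rw [F.tangent_eq_ker_differential hφ hx]; exact h)
    obtain ⟨f, hf, hfe⟩ := exists_normalizedForm_eventually_eq (g := g) (smoothFormAt_mfderiv hsm)
      hX.continuousAt hβX (hF.inverse_ne_zero (F.tangent_eq_ker_differential hφ hx)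
        (F.differential_height_ne_zero hφ hx))
    have hfe' : ∀ᶠ y in 𝓝 x,
        normalizedForm g X F.conormal y = f y • differential (height φ) y := by
      filter_upwards [hfe, φ.open_source.mem_nhds hx] with y hy hyφ
      rw [← hy]
      refine normalizedForm_eq_of_ker_eq (F.differential_height_ne_zero hφ hyφ) ?_
      rw [← F.tangent_eq_ker_conormal, F.tangent_eq_ker_differential hφ hyφ]
    have hs := ((smoothFormAt_mfderiv hsm).smul hf).congr hfe'
    exact ⟨hs, wedgeExtDerivative_eq_zero hs hf hsm hfe'⟩
  refine ⟨normalizedForm g X F.conormal, ⟨smoothFormOn_of_forall fun x _ ↦ (hloc x).1,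
    fun x _ ↦ (hloc x).2, fun x _ ↦ hF.inverse_ne_zero (hker x) fun h ↦ ?_⟩, hker⟩
  have h1 := hker x
  rw [h] at h1
  exact hXF x (by rw [h1]; rfl)

theorem continuous_sharp (hθ : ∀ x, SmoothFormAt θ x) :
    Continuous (fun x : V ↦ (⟨x, g.sharp x (θ x)⟩ : TangentBundle (𝓡 (n + 1)) V)) :=
  continuous_iff_continuousAt.2 fun x ↦
    (continuousAt_section_iff _ x).2 (contMDiffAt_coordDeriv_sharp g (hθ x)).continuousAt

end Orientation

end CodimOne

end

theorem mainTheorem3 {n : ℕ} {V : Type*} [TopologicalSpace V] [T2Space V]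
    [SecondCountableTopology V] [ChartedSpace (EuclideanSpace ℝ (Fin (n + 1))) V]
    [IsManifold (𝓡 (n + 1)) ∞ V] (g : CodimOne.PseudoRiemannianMetric n V) :
    (∀ F : CodimOne.Foliation n V, F.IsNondegenerate g →
      ∃ P Q : CodimOne.EndoField n V,
        CodimOne.IsProjectorPair g F.tangent P Q ∧
        (∀ P' Q' : CodimOne.EndoField n V,
          CodimOne.IsProjectorPair g F.tangent P' Q' → P' = P ∧ Q' = Q) ∧
        (∀ x : V, ∃ U : Set V, IsOpen U ∧ x ∈ U ∧ ∃ θ : CodimOne.CovectorField n V,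
          CodimOne.IsIntegrableNonNullOn g θ U ∧
          ∀ y ∈ U, P y = g.formProjector θ y ∧
            Q y = ContinuousLinearMap.id ℝ (TangentSpace (𝓡 (n + 1)) y) - P y) ∧
        (F.IsTransverselyOrientable ↔ ∃ θ : CodimOne.CovectorField n V,
          CodimOne.IsIntegrableNonNullOn g θ Set.univ ∧
          ∀ y, P y = g.formProjector θ y ∧
            Q y = ContinuousLinearMap.id ℝ (TangentSpace (𝓡 (n + 1)) y) - P y) ∧
        (∀ t : V → ℝ, ContMDiff (𝓡 (n + 1)) 𝓘(ℝ, ℝ) ∞ t →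
          (∀ x, mfderiv (𝓡 (n + 1)) 𝓘(ℝ, ℝ) t x ≠ 0) →
          (∀ x, ∀ y ∈ F.leaf x, t y = t x) →
          ∃ θ : CodimOne.CovectorField n V,
            (∀ x, θ x = mfderiv (𝓡 (n + 1)) 𝓘(ℝ, ℝ) t x) ∧
            CodimOne.IsIntegrableNonNullOn g θ Set.univ ∧
            ∀ y, P y = g.formProjector θ y ∧
              Q y = ContinuousLinearMap.id ℝ (TangentSpace (𝓡 (n + 1)) y) - P y)) ∧
    (∀ θ : CodimOne.CovectorField n V, CodimOne.IsIntegrableNonNullOn g θ Set.univ →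
      ∃! F : CodimOne.Foliation n V,
        (∀ x, F.tangent x = LinearMap.ker (θ x).toLinearMap) ∧
        F.IsNondegenerate g ∧
        CodimOne.IsProjectorPair g F.tangent (g.formProjector θ)
          (fun x ↦ ContinuousLinearMap.id ℝ (TangentSpace (𝓡 (n + 1)) x) -
            g.formProjector θ x)) := by 
  refine ⟨fun F hF ↦ ⟨g.formProjector F.conormal, fun x ↦
    ContinuousLinearMap.id ℝ (TangentSpace (𝓡 (n + 1)) x) - g.formProjector F.conormal x,
    hF.isProjectorPair, fun P' Q' h ↦ hF.isProjectorPair.unique h, fun x ↦ ?_, ⟨?_, ?_⟩,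
    fun t ht hne hconst ↦ ?_⟩, fun θ hθ ↦ ?_⟩
  · obtain ⟨φ, hφ, hx⟩ := F.cover x
    exact ⟨φ.source, φ.open_source, hx, CodimOne.differential (CodimOne.height φ),
      hF.isIntegrableNonNullOn_height hφ, fun y hy ↦
      ⟨CodimOne.Foliation.formProjector_conormal_eq (F.tangent_eq_ker_differential hφ hy), rfl⟩⟩
  · rintro ⟨X, hX, hXF⟩
    obtain ⟨θ, hθ, hker⟩ := hF.exists_form_of_transverse hX hXF
    exact ⟨θ, hθ, fun y ↦ ⟨CodimOne.Foliation.formProjector_conormal_eq (hker y), rfl⟩⟩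
  · rintro ⟨θ, hθ, hP⟩
    refine ⟨fun x ↦ g.sharp x (θ x), CodimOne.continuous_sharp fun x ↦
      hθ.smooth.smoothFormAt Filter.univ_mem, fun x hx ↦ ?_⟩
    have hθx := hθ.nonNull x (Set.mem_univ x)
    have h1 := g.formProjector_eq_zero_iff hθx (g.sharp x (θ x))
    rw [← (hP x).1, g.formProjector_eq_zero_iff (hF.inverse_ne_zero
      (F.tangent_eq_ker_conormal x) (F.conormal_ne_zero x))] at h1
    rw [F.tangent_eq_ker_conormal] at hx
    exact hθx ((g.inverse_eq _ _).trans (h1.1 hx))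
  · have hker : ∀ x, F.tangent x = LinearMap.ker (CodimOne.differential t x).toLinearMap :=
      fun x ↦ CodimOne.Foliation.tangent_eq_ker_of_const
        (ht.mdifferentiable (by simp) x) (hne x) (hconst x)
    exact ⟨CodimOne.differential t, fun x ↦ rfl,
      CodimOne.isIntegrableNonNullOn_differential isOpen_univ ht.contMDiffOn
        fun x _ ↦ hF.inverse_ne_zero (hker x) (hne x),
      fun y ↦ ⟨CodimOne.Foliation.formProjector_conormal_eq (hker y), rfl⟩⟩
  · have hsm : ∀ x, CodimOne.SmoothFormAt θ x := fun x ↦ hθ.smooth.smoothFormAt Filter.univ_mem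
    have hnn := fun x ↦ hθ.nonNull x (Set.mem_univ x)
    have hne : ∀ x, θ x ≠ 0 := fun x ↦ g.ne_zero_of_inverse_ne_zero (hnn x)
    have hker := CodimOne.tangent_foliationOfForm hsm
      (fun x ↦ hθ.integrable x (Set.mem_univ x)) hne
    refine ⟨CodimOne.foliationOfForm hsm (fun x ↦ hθ.integrable x (Set.mem_univ x)) hne,
      ⟨hker, (CodimOne.Foliation.isNondegenerate_iff hker hne).2 hnn, ?_⟩, fun F hF ↦ ?_⟩
    · exact CodimOne.isProjectorPair_formProjector hker hnn fun x ↦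
        ⟨θ, hsm x, hne x, Filter.Eventually.of_forall fun y ↦ rfl⟩
    · exact CodimOne.Foliation.eq_of_tangent_eq fun x ↦ (hF.1 x).trans (hker x).symm
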